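/- Let $\epsilon>0$, let $P\ge 0$ be an integer, let $c_1,\dots,c_P$ be nonzero complex numbers with $\sum_{p=1}^P(c_p+c_p^*)=0$, and let $z_1,\dots,z_P\in\mathbb{C}$ satisfy $\mathrm{Im}\,z_p>0$ and $\mathrm{Re}\,z_1<\dots<\mathrm{Re}\,z_P$. Let $G$ be the complex plane with the vertical half-lines $z_p+i[0,\infty)$ and $z_p^*-i[0,\infty)$, $p=1,\dots,P$, removed, and on $G$ put, with the principal logarithm, $$f(x)=\sum_{p=1}^P\Big[c_p\big(\mathrm{Log}(i(x-z_p))+\tfrac{\pi i}{2}\big)+c_p^*\big(\mathrm{Log}(-i(x-z_p^*))-\tfrac{\pi i}{2}\big)\Big],\qquad h(x;\lambda)=\lambda x+f(x).$$ Let $\lambda<0$ and $\phi_1,\dots,\phi_P\in\mathbb{C}$. For $x\in G$ set $$\Phi(x;\lambda)=-\frac{i}{\epsilon}\,e^{ih(x;\lambda)/\epsilon}\int_{-\infty}^{x}e^{-ih(z;\lambda)/\epsilon}\sum_{p=1}^P\frac{\phi_p}{z-z_p}\,dz ,$$ where the integral is taken in $G$, along the real axis from $-\infty$ to $\mathrm{Re}\,x$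 as an improper integral, and then along the vertical segment to $x$. For $m=0,\dots,P$ let $G_m$ denote the part far up in $G$ of the region lying to the right of $z_1,\dots,z_m$ and to the left of $z_{m+1},\dots,z_P$. Contours are piecewise continuously differentiable. A contour *starts at $i\infty$ in $G_0$* (or *ends at $i\infty$ in $G_m$*) if the corresponding tail lies over $G_0$ (over $G_m$), its height $\mathrm{Im}\,z$ tends to $+\infty$, and $|dz|\le K\,|d\,\mathrm{Im}\,z|$ with $\mathrm{Im}\,z$ monotone along the tail, for some constant $K$ (for instance, a vertical ray). For $m=1,\dots,P$ let $C_m^<$ be * any contour in $G$ from $i\infty$ in $G_0$ to $i\infty$ in $G_m$, if $ic_m/\epsilon$ is not a strictly negative integer; * any contour from $i\infty$ in $G_0$ to the point $z_m$ that lies in $G$ except for its endpoint $z_m$, if $ic_m/\epsilon$ is a strictly negative integer. Then the improper integral defining $\Phi$ converges, the integrals below are absolutely convergent, and $\Phi(\cdot;\lambda)$ is analytic in the upper half-plane (that is, its restriction to $G\cap\{\mathrm{Im}\,x>0\}$ extends to an analytic function on $\{\mathrm{Im}\,x>0\}$) if and only if $$\int_{C_m^<}e^{-ih(z;\lambda)/\epsilon}\sum_{p=1}^P\frac{\phi_p}{z-z_p}\,dz=0,\qquad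 m=1,\dots,P.$$ -/

import Mathlib

open Complex Filter Topology MeasureTheory

noncomputable section

namespace BenjaminOno

variable {P : ℕ}

/-- The domain `G`: the plane without the closed vertical half-lines going up from each `z p` and
down from each `conj (z p)`. This is the set where `I * (x - z p)` and `-I * (x - conj (z p))` avoid
the cut `(-∞, 0]` of the principal logarithm. -/
def domainG (z : Fin P → ℂ) : Set ℂ :=
  {x | ∀ p, I * (x - z p) ∈ slitPlane ∧ -I * (x - (starRingEnd ℂ) (z p)) ∈ slitPlane}

/-- The antiderivative `f` of `u₀ = ∑ p, c p / (x - z p) + c.c.`, with principal logarithms. -/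
def f (c z : Fin P → ℂ) (x : ℂ) : ℂ :=
  ∑ p, (c p * (log (I * (x - z p)) + Real.pi * I / 2) +
    (starRingEnd ℂ) (c p) * (log (-I * (x - (starRingEnd ℂ) (z p))) - Real.pi * I / 2))

/-- `h(x; lam) = lam * x + f(x)`. -/
def h (lam : ℝ) (c z : Fin P → ℂ) (x : ℂ) : ℂ := lam * x + f c z x

/-- The integrand `exp (-i h(w; lam) / ε) * ∑ p, φ p / (w - z p)`. -/
def integrand (ε lam : ℝ) (c z φ : Fin P → ℂ) (w : ℂ) : ℂ :=
  exp (-I * h lam c z w / ε) * ∑ p, φ p / (w - z p)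

/-- The improper integral of the integrand from `-∞` to `x` in `G`, taken along the real axis from
`-∞` to `Re x` (as a limit of integrals over `[-A, Re x]`) and then along the vertical segment from
`Re x` to `x`; this segment lies in `G` whenever `x` does. For real `x` it is the integral over
`(-∞, x]`. -/
def integralFromNegInfty (ε lam : ℝ) (c z φ : Fin P → ℂ) (x : ℂ) : ℂ :=
  limUnder atTop (fun A : ℝ => ∫ s in (-A)..x.re, integrand ε lam c z φ (s : ℂ)) +
    ∫ s in (0 : ℝ)..x.im, integrand ε lam c z φ ((x.re : ℂ) + s * I) * I

/-- The candidate eigenfunction `Φ(x; lam)`, for `x` in `G`. -/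
def Phi (ε lam : ℝ) (c z φ : Fin P → ℂ) (x : ℂ) : ℂ :=
  -(I / ε) * exp (I * h lam c z x / ε) * integralFromNegInfty ε lam c z φ x

/-- `Φ(·; lam)` is analytic in the open upper half-plane: its singularities on the upper cuts of
`G` are removable, i.e. `Φ` on `G ∩ {Im x > 0}` is the restriction of a function analytic on the
whole of `{Im x > 0}`. -/
def PhiAnalyticUpper (ε lam : ℝ) (c z φ : Fin P → ℂ) : Prop :=
  ∃ Ψ : ℂ → ℂ, AnalyticOnNhd ℂ Ψ {x | 0 < x.im} ∧
    ∀ x ∈ domainG z, 0 < x.im → Ψ x = Phi ε lam c z φ x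

/-- The open vertical strip (a half-plane if `k = 0` or `k = P`) to the right of the first `k`
of the poles and to the left of the others. Far up, it is the subdomain `G_k` of `G`. -/
def column (z : Fin P → ℂ) (k : ℕ) : Set ℂ :=
  {x | ∀ p : Fin P, (p.val < k → (z p).re < x.re) ∧ (k ≤ p.val → x.re < (z p).re)}

/-- `γ` is piecewise continuously differentiable on the interval `J`, with finitely many corners. -/
def PiecewiseC1On (γ : ℝ → ℂ) (J : Set ℝ) : Prop :=
  ContinuousOn γ J ∧ ∃ S : Finset ℝ, ∀ a b : ℝ, a < b → Set.Icc a b ⊆ J →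
    Disjoint (Set.Ioo a b) (S : Set ℝ) → ContDiffOn ℝ 1 γ (Set.Icc a b)

/-- `γ` originates at `i∞` in `G_0`: for `t` near `-∞` it lies over the region `G_0`, its height
tends to `+∞` as `t → -∞`, and the tail has a slope bounded below, `|dγ| ≤ K |d Im γ|`, with
`Im γ` monotone (vertical rays have `K = 1`). -/
def StartsAtTop (z : Fin P → ℂ) (γ : ℝ → ℂ) : Prop :=
  Tendsto (fun t => (γ t).im) atBot atTop ∧
    ∃ K T : ℝ, ∀ t ≤ T, γ t ∈ column z 0 ∧ ‖deriv γ t‖ ≤ K * -(deriv γ t).im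

/-- `γ` ends at `i∞` in `G_k`, in the same sense, as `t → +∞`. -/
def EndsAtTop (z : Fin P → ℂ) (k : ℕ) (γ : ℝ → ℂ) : Prop :=
  Tendsto (fun t => (γ t).im) atTop atTop ∧
    ∃ K T : ℝ, ∀ t ≥ T, γ t ∈ column z k ∧ ‖deriv γ t‖ ≤ K * (deriv γ t).im

/-- `γ`, parametrized by `ℝ`, is a contour `U_k^<`: it runs in `G` from `i∞` in `G_0` to
`i∞` in `G_k`. -/
def IsContourU (z : Fin P → ℂ) (k : ℕ) (γ : ℝ → ℂ) : Prop :=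
  PiecewiseC1On γ Set.univ ∧ (∀ t, γ t ∈ domainG z) ∧ StartsAtTop z γ ∧ EndsAtTop z k γ

/-- `γ`, parametrized by `(-∞, 0]`, is a contour `ℓ_0(z m)`: it runs from `i∞` in `G_0` to the
branch point `z m`, and lies in `G` except for its endpoint. -/
def IsContourEll (z : Fin P → ℂ) (m : Fin P) (γ : ℝ → ℂ) : Prop :=
  PiecewiseC1On γ (Set.Iic 0) ∧ (∀ t < 0, γ t ∈ domainG z) ∧ γ 0 = z m ∧ StartsAtTop z γ

/-- The exceptional case for the index `m`: `i c_m / ε` is a strictly negative integer. -/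
def Exceptional (ε : ℝ) (c : Fin P → ℂ) (m : Fin P) : Prop :=
  ∃ n : ℕ, 0 < n ∧ I * c m / ε = -(n : ℂ)

open Classical in
/-- `γ` is a contour `C_m^<`. The index `m : Fin P` stands for the pole number `m.val + 1`, so the
non-exceptional contour ends in `G_(m.val + 1)`, just to the right of the pole `z m`. -/
def IsContourC (ε : ℝ) (c z : Fin P → ℂ) (m : Fin P) (γ : ℝ → ℂ) : Prop :=
  if Exceptional ε c m then IsContourEll z m γ else IsContourU z (m.val + 1) γ

open Classical in
/-- The parameter interval of the contour `C_m^<`. -/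
def contourParam (ε : ℝ) (c : Fin P → ℂ) (m : Fin P) : Set ℝ :=
  if Exceptional ε c m then Set.Iic 0 else Set.univ

end BenjaminOno

end

/-! ### Complex-analytic tools: wedge primitives, limits at `i∞`, gluing of local extensions. -/

namespace BenjaminOno

/-! Write `E = exp (-i h / ε)` and let `F` be the contour integral from `-∞`, so that `Φ` is a
constant multiple of `F / E`. Away from the poles and for `Im w ≥ 0`, `|E|` is at most a constant
times `exp (lam * Im w / ε)`. As `lam < 0`, `F` has a limit `L k` at `i∞` in the column `G_k`, and
pushing the path from `-∞` upwards gives `L 0 = 0` (`exists_column_limit_integralFromNegInfty`). The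
integral over a contour from `i∞` in `G_0` to `i∞` in `G_k` is therefore `L k`.

Let `ρ = exp (π c_m / ε)`. Turning the cut at `z m` downwards gives functions `Q` and `E₀`
holomorphic across the upper cut, with `F = Q / ρ + L m`, `E = E₀ / ρ` on its left and `F = Q ρ + L
(m+1)`, `E = E₀ ρ` on its right (`exists_continuation`). So `F / E` continues across the open cut
exactly when `L (m+1) = ρ² L m`. Since `L 0 = 0`, this holds for all cuts exactly when all `L k`
vanish.

At `z m` put `α = Im c_m / ε`. There `|E|` is comparable to `|w - z m|^α` and the integrand is `O(|w
- z m|^(α-1))`. If `α ≤ 0` and the limits `L k` vanish, `F / E` grows at most logarithmically, so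
the singularity is removable. If `α > 0`, then `F` has a limit `Fm` at `z m`, and removability also
requires `Fm = 0`. Descending to `z m` along both sides of the cut gives `ρ² (L m - Fm) = L (m+1) -
Fm` (`limit_relation_at_branchPoint`). When `ρ² ≠ 1`, vanishing of `L m` and `L (m+1)` forces `Fm =
0`. When `ρ² = 1`, which for `α > 0` is the exceptional case, `L (m+1) = L m` is automatic and `Fm =
0` is a separate condition: the vanishing of the integral over the contour that ends at `z m`.
Either way there is one condition per pole. -/

open scoped Interval in
/-- On an open set that contains the wedge path from `b` to each of its points, the wedge integral
of a holomorphic function is a primitive. -/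
theorem hasDerivAt_wedgeIntegral_of_wedge_subset {U : Set ℂ} (hU : IsOpen U) {b : ℂ}
    (hbase : ∀ x ∈ U, ∀ s ∈ [[b.re, x.re]], (s + b.im * I : ℂ) ∈ U)
    (hvert : ∀ x ∈ U, ∀ t ∈ [[b.im, x.im]], (x.re + t * I : ℂ) ∈ U)
    {g : ℂ → ℂ} (hg : DifferentiableOn ℂ g U) {x : ℂ} (hx : x ∈ U) :
    HasDerivAt (fun w => wedgeIntegral b w g) (g x) x := by
  set K : Set ℂ := (fun t : ℝ => (x.re + t * I : ℂ)) '' [[b.im, x.im]] with hK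
  have hKc : IsCompact K := isCompact_uIcc.image (by fun_prop)
  have hKU : K ⊆ U := by
    rintro _ ⟨t, ht, rfl⟩
    exact hvert x hx t ht
  obtain ⟨δ, hδ, hδU⟩ := hKc.exists_thickening_subset_open hU hKU
  -- A thin tube around the vertical leg of the path to `x` stays in `U`; everything below takes
  -- place in this tube.
  have hnear : ∀ s t : ℝ, |s - x.re| < δ → t ∈ [[b.im, x.im]] → (s + t * I : ℂ) ∈ U := by
    intro s t hs ht
    apply hδU
    rw [Metric.mem_thickening_iff]
    refine ⟨x.re + t * I, ⟨t, ht, rfl⟩, ?_⟩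
    have : (s + t * I : ℂ) - (x.re + t * I) = ((s - x.re : ℝ) : ℂ) := by push_cast; ring
    rw [dist_eq, this, norm_real]
    exact hs
  have hball : Metric.ball x δ ⊆ U := by
    refine Set.Subset.trans ?_ hδU
    have hxK : x ∈ K := ⟨x.im, Set.right_mem_uIcc, by simp [re_add_im]⟩
    exact Metric.ball_subset_thickening hxK δ
  have hloc : HasDerivAt (fun w => wedgeIntegral x w g) (g x) x :=
    (hg.mono hball).isConservativeOn.hasDerivAt_wedgeIntegral (hg.mono hball).continuousOn
      (Metric.mem_ball_self hδ)
  refine (hloc.const_add (wedgeIntegral b x g)).congr_of_eventuallyEq ?_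
  filter_upwards [Metric.ball_mem_nhds x hδ] with w hw
  have hwU : w ∈ U := hball hw
  have hre : |w.re - x.re| < δ := by
    rw [Metric.mem_ball, dist_eq] at hw
    exact (by simpa using abs_re_le_norm (w - x) : |w.re - x.re| ≤ ‖w - x‖).trans_lt hw
  have hgc := hg.continuousOn
  have hseg : ∀ s ∈ [[x.re, w.re]], |s - x.re| < δ := by
    intro s hs
    exact (Set.abs_sub_left_of_mem_uIcc hs).trans_lt hre
  have i1 : IntervalIntegrable (fun s : ℝ => g (s + b.im * I)) volume b.re x.re :=
    (hgc.comp (by fun_prop) (fun s hs => hbase x hx s hs)).intervalIntegrable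
  have i2 : IntervalIntegrable (fun s : ℝ => g (s + b.im * I)) volume x.re w.re :=
    (hgc.comp (by fun_prop) (fun s hs =>
      hnear s _ (hseg s hs) Set.left_mem_uIcc)).intervalIntegrable
  have hxw : (w.re + x.im * I : ℂ) ∈ U := hnear _ _ hre Set.right_mem_uIcc
  have i3 : IntervalIntegrable (fun t : ℝ => g (w.re + t * I)) volume b.im x.im :=
    (hgc.comp (by fun_prop) (fun t ht => hnear _ t hre ht)).intervalIntegrable
  have i4 : IntervalIntegrable (fun t : ℝ => g (w.re + t * I)) volume x.im w.im := by
    have i5 : IntervalIntegrable (fun t : ℝ => g (w.re + t * I)) volume b.im w.im :=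
      (hgc.comp (by fun_prop) (fun t ht => hvert w hwU t ht)).intervalIntegrable
    exact i3.symm.trans i5
  -- The wedge to `w` and the wedge to `x` followed by the short wedge from `x` to `w` differ by the
  -- boundary of a rectangle in the tube.
  have hrect := integral_boundary_rect_eq_zero_of_differentiableOn g (x.re + b.im * I)
    (w.re + x.im * I) (hg.mono (by
      intro v hv
      rw [mem_reProdIm] at hv
      simp only [add_re, ofReal_re, mul_re, I_re, mul_zero, ofReal_im, I_im, mul_one, sub_self,
        add_zero, add_im, mul_im, zero_add] at hv
      rw [← re_add_im v]
      exact hnear _ _ (hseg _ hv.1) hv.2))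
  simp only [add_re, ofReal_re, mul_re, I_re, mul_zero, ofReal_im, I_im, mul_one, sub_self,
        add_zero, add_im, mul_im, zero_add] at hrect
  simp only [wedgeIntegral]
  rw [← intervalIntegral.integral_add_adjacent_intervals i1 i2,
    ← intervalIntegral.integral_add_adjacent_intervals i3 i4]
  simp only [smul_eq_mul] at hrect ⊢
  linear_combination hrect

theorem hasDerivAt_comp_vertical {X : ℂ → ℂ} {d : ℂ} {x y : ℝ} (h : HasDerivAt X d (x + y * I)) :
    HasDerivAt (fun y : ℝ => X (x + y * I)) (d * I) y := by
  have h1 : HasDerivAt (fun y : ℝ => (x + y * I : ℂ)) I y := by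
    simpa using ((hasDerivAt_id y).ofReal_comp.mul_const I).const_add (x : ℂ)
  exact HasDerivAt.comp y h h1

/-- A function whose derivative decays exponentially in the upward direction on a half-strip tends
exponentially fast to a limit at `i∞`. -/
theorem exists_limit_of_deriv_exp_decay {X g : ℂ → ℂ} {J : Set ℝ} (hJ : J.OrdConnected)
    {Y₀ M κ : ℝ} (hκ : 0 < κ)
    (hX : ∀ w : ℂ, w.re ∈ J → Y₀ < w.im → HasDerivAt X (g w) w)
    (hg : ∀ w : ℂ, w.re ∈ J → Y₀ < w.im → ‖g w‖ ≤ M * Real.exp (-κ * w.im)) :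
    ∃ L : ℂ, ∀ w : ℂ, w.re ∈ J → Y₀ < w.im → ‖X w - L‖ ≤ M / κ * Real.exp (-κ * w.im) := by
  have hline : ∀ s ∈ J, ∀ y, Y₀ < y →
      HasDerivAt (fun y : ℝ => X (s + y * I)) (g (s + y * I) * I) y := by
    intro s hs y hy
    exact hasDerivAt_comp_vertical (hX (s + y * I) (by simpa using hs) (by simpa using hy))
  have hbd : ∀ s ∈ J, ∀ y, Y₀ < y → ‖g (s + y * I) * I‖ ≤ M * Real.exp (-κ * y) := by
    intro s hs y hy
    simpa using hg (s + y * I) (by simpa using hs) (by simpa using hy)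
  have hexp : ∀ y₁, IntegrableOn (fun y => M * Real.exp (-κ * y)) (Set.Ioi y₁) := fun y₁ =>
    (exp_neg_integrableOn_Ioi y₁ hκ).const_mul M
  have hray : ∀ s ∈ J, ∃ L : ℂ, Tendsto (fun y : ℝ => X (s + y * I)) atTop (𝓝 L) ∧
      ∀ y, Y₀ < y → ‖X (s + y * I) - L‖ ≤ M / κ * Real.exp (-κ * y) := by
    intro s hs
    have hint : ∀ y₁, Y₀ < y₁ → IntegrableOn (fun y : ℝ => g (s + y * I) * I) (Set.Ioi y₁) := by
      intro y₁ hy₁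
      refine Integrable.mono' (hexp y₁) ?_ ?_
      -- `g` is not assumed measurable, but on the ray it agrees with a derivative up to the factor
      -- `I`, and derivatives are measurable.
      · have : AEStronglyMeasurable (deriv fun y : ℝ => X (s + y * I))
            (volume.restrict (Set.Ioi y₁)) := (stronglyMeasurable_deriv _).aestronglyMeasurable
        refine this.congr ?_
        filter_upwards [ae_restrict_mem measurableSet_Ioi] with y hy
        exact (hline s hs y (hy₁.trans hy)).deriv
      · filter_upwards [ae_restrict_mem measurableSet_Ioi] with y hy
        exact hbd s hs y (hy₁.trans hy)
    have hlim := tendsto_limUnder_of_hasDerivAt_of_integrableOn_Ioi (a := Y₀ + 1)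
      (fun y hy => hline s hs y (by have : Y₀ + 1 < y := hy; linarith)) (hint (Y₀ + 1) (by linarith))
    refine ⟨_, hlim, fun y hy => ?_⟩
    have h1 := integral_Ioi_of_hasDerivAt_of_tendsto' (a := y)
      (fun t ht => hline s hs t (lt_of_lt_of_le hy ht)) (hint y hy) hlim
    rw [norm_sub_rev, ← h1]
    refine (norm_integral_le_of_norm_le (hexp y) ?_).trans (le_of_eq ?_)
    · filter_upwards [ae_restrict_mem measurableSet_Ioi] with t ht
      exact hbd s hs t (hy.trans ht)
    · rw [integral_const_mul, integral_exp_mul_Ioi (by linarith)]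
      field_simp
  by_cases hne : J.Nonempty
  swap
  · exact ⟨0, fun w hw => absurd ⟨_, hw⟩ hne⟩
  obtain ⟨s₀, hs₀⟩ := hne
  obtain ⟨L, hL, -⟩ := hray s₀ hs₀
  refine ⟨L, fun w hw hY => ?_⟩
  obtain ⟨L', hL', hL'b⟩ := hray w.re hw
  -- Rays over different abscissas have the same limit: a horizontal segment at height `y`
  -- contributes at most its length times `M exp (-κ y)`.
  have hLL : L' = L := by
    have hdiff : ∀ y, Y₀ < y → ‖X (w.re + y * I) - X (s₀ + y * I)‖ ≤
        M * Real.exp (-κ * y) * |w.re - s₀| := by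
      intro y hy
      have hd : ∀ s ∈ Set.uIcc s₀ w.re, HasDerivWithinAt (fun s : ℝ => X (s + y * I))
          (g (s + y * I)) (Set.uIcc s₀ w.re) s := by
        intro s hs
        have hsJ : s ∈ J := hJ.uIcc_subset hs₀ hw hs
        have h1 : HasDerivAt (fun s : ℝ => (s + y * I : ℂ)) 1 s := by
          simpa using ((hasDerivAt_id s).ofReal_comp).add_const (y * I : ℂ)
        have h2 := HasDerivAt.comp s (hX (s + y * I) (by simpa using hsJ) (by simpa using hy)) h1
        rw [mul_one] at h2
        exact h2.hasDerivWithinAt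
      have := (convex_uIcc s₀ w.re).norm_image_sub_le_of_norm_hasDerivWithin_le hd
        (C := M * Real.exp (-κ * y)) (fun s hs => by
          simpa using hg (s + y * I) (by simpa using hJ.uIcc_subset hs₀ hw hs) (by simpa using hy))
        Set.left_mem_uIcc Set.right_mem_uIcc
      simpa [Real.norm_eq_abs] using this
    have h0 : Tendsto (fun y : ℝ => M * Real.exp (-κ * y) * |w.re - s₀|) atTop (𝓝 0) := by
      have : Tendsto (fun y : ℝ => Real.exp (-κ * y)) atTop (𝓝 0) :=
        Real.tendsto_exp_atBot.comp (tendsto_id.const_mul_atTop_of_neg (by linarith))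
      simpa using (this.const_mul M).mul_const (|w.re - s₀|)
    have h1 : Tendsto (fun y : ℝ => X (w.re + y * I) - X (s₀ + y * I)) atTop (𝓝 0) :=
      squeeze_zero_norm' ((eventually_gt_atTop Y₀).mono hdiff) h0
    exact sub_eq_zero.1 (tendsto_nhds_unique (hL'.sub hL) h1)
  simpa [hLL, re_add_im] using hL'b w.im hY

/-- Locally extendable functions on the dense trace of `G` extend: the local extensions agree. -/
theorem exists_analytic_extension {G U : Set ℂ} (hG : Dense G) {Φ : ℂ → ℂ}
    (hloc : ∀ w ∈ U, ∃ Θ : ℂ → ℂ, AnalyticAt ℂ Θ w ∧ ∀ᶠ v in 𝓝 w, v ∈ G → Θ v = Φ v) :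
    ∃ Ψ : ℂ → ℂ, AnalyticOnNhd ℂ Ψ U ∧ ∀ w ∈ U, w ∈ G → Ψ w = Φ w := by
  have key : ∀ w ∈ U, ∃ Θ : ℂ → ℂ, AnalyticAt ℂ Θ w ∧
      (∀ᶠ v in 𝓝 w, v ∈ G → Θ v = Φ v) ∧ ∀ᶠ v in 𝓝 w, limUnder (𝓝[G] v) Φ = Θ v := by
    intro w hw
    obtain ⟨Θ, hΘ, he⟩ := hloc w hw
    refine ⟨Θ, hΘ, he, ?_⟩
    filter_upwards [he.eventually_nhds, hΘ.eventually_analyticAt] with v hv hva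
    have : (𝓝[G] v).NeBot := mem_closure_iff_nhdsWithin_neBot.1 (hG v)
    refine Tendsto.limUnder_eq ((hva.continuousAt.tendsto.mono_left nhdsWithin_le_nhds).congr' ?_)
    filter_upwards [nhdsWithin_le_nhds hv, self_mem_nhdsWithin] with x hx hxG using hx hxG
  -- Reading the value off as a limit of `Φ` along `G` involves no choice, so the local extensions
  -- agree without any argument on overlaps.
  refine ⟨fun w => limUnder (𝓝[G] w) Φ, fun w hw => ?_, fun w hw hwG => ?_⟩
  · obtain ⟨Θ, hΘ, -, h2⟩ := key w hw
    exact hΘ.congr (h2.mono fun v hv => hv.symm)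
  · obtain ⟨Θ, hΘ, h1, h2⟩ := key w hw
    exact h2.self_of_nhds.trans (h1.self_of_nhds hwG)

end BenjaminOno

/-! ### Integration along piecewise continuously differentiable curves. -/

namespace BenjaminOno

theorem integrableOn_deriv_of_contDiffOn_Icc {γ : ℝ → ℂ} {a b : ℝ} (hab : a ≤ b)
    (h : ContDiffOn ℝ 1 γ (Set.Icc a b)) : IntegrableOn (deriv γ) (Set.Icc a b) := by
  rcases hab.eq_or_lt with rfl | hlt
  · simp
  rw [integrableOn_Icc_iff_integrableOn_Ioo]
  have h1 : IntegrableOn (derivWithin γ (Set.Icc a b)) (Set.Ioo a b) :=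
    ((h.continuousOn_derivWithin (uniqueDiffOn_Icc hlt) le_rfl).integrableOn_Icc).mono_set
      Set.Ioo_subset_Icc_self
  refine h1.congr_fun (fun t ht => ?_) measurableSet_Ioo
  exact derivWithin_of_mem_nhds (Icc_mem_nhds ht.1 ht.2)

/-- Induction on the set of corners, splitting the interval at one corner at a time. The hypothesis
ranges over all subintervals so that it survives the splitting. -/
theorem integrableOn_deriv_of_piecewise (γ : ℝ → ℂ) (S : Finset ℝ) : ∀ a b : ℝ, a ≤ b →
    (∀ a' b' : ℝ, a' < b' → Set.Icc a' b' ⊆ Set.Icc a b →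
      Disjoint (Set.Ioo a' b') (S : Set ℝ) → ContDiffOn ℝ 1 γ (Set.Icc a' b')) →
    IntegrableOn (deriv γ) (Set.Icc a b) := by
  induction S using Finset.induction_on with
  | empty =>
    intro a b hab h
    rcases hab.eq_or_lt with rfl | hlt
    · simp
    exact integrableOn_deriv_of_contDiffOn_Icc hab (h a b hlt subset_rfl (by simp))
  | insert s S _ ih =>
    intro a b hab h
    by_cases hs : s ∈ Set.Icc a b
    · rw [← Set.Icc_union_Icc_eq_Icc hs.1 hs.2]
      refine IntegrableOn.union (ih a s hs.1 fun a' b' hlt hsub hd => ?_)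
        (ih s b hs.2 fun a' b' hlt hsub hd => ?_)
      · refine h a' b' hlt (hsub.trans (Set.Icc_subset_Icc_right hs.2)) ?_
        rw [Finset.coe_insert, Set.disjoint_insert_right]
        exact ⟨fun hm => hm.2.not_ge (hsub (Set.right_mem_Icc.2 hlt.le)).2, hd⟩
      · refine h a' b' hlt (hsub.trans (Set.Icc_subset_Icc_left hs.1)) ?_
        rw [Finset.coe_insert, Set.disjoint_insert_right]
        exact ⟨fun hm => hm.1.not_ge (hsub (Set.left_mem_Icc.2 hlt.le)).1, hd⟩
    · refine ih a b hab fun a' b' hlt hsub hd => h a' b' hlt hsub ?_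
      rw [Finset.coe_insert, Set.disjoint_insert_right]
      exact ⟨fun hm => hs (hsub (Set.Ioo_subset_Icc_self hm)), hd⟩

namespace PiecewiseC1On

variable {γ : ℝ → ℂ} {J : Set ℝ} {a b : ℝ}

theorem integrableOn_deriv (hγ : PiecewiseC1On γ J) (hab : a ≤ b) (hJ : Set.Icc a b ⊆ J) :
    IntegrableOn (deriv γ) (Set.Icc a b) := by
  obtain ⟨-, S, hS⟩ := hγ
  exact integrableOn_deriv_of_piecewise γ S a b hab fun a' b' hlt hsub hd =>
    hS a' b' hlt (hsub.trans hJ) hd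

/-- At corners `deriv` may be a default value; the fundamental theorem of calculus used below
tolerates a countable exceptional set. -/
theorem exists_finset_differentiableAt (hγ : PiecewiseC1On γ J) :
    ∃ S : Finset ℝ, ∀ t ∈ interior J, t ∉ S → DifferentiableAt ℝ γ t := by
  obtain ⟨-, S, hS⟩ := hγ
  refine ⟨S, fun t ht htS => ?_⟩
  have hnh : interior J ∩ (S : Set ℝ)ᶜ ∈ 𝓝 t :=
    inter_mem (isOpen_interior.mem_nhds ht) (S.finite_toSet.isClosed.isOpen_compl.mem_nhds htS)
  obtain ⟨δ, hδ, hsub⟩ := Metric.nhds_basis_closedBall.mem_iff.1 hnh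
  rw [Real.closedBall_eq_Icc] at hsub
  have hd : Disjoint (Set.Ioo (t - δ) (t + δ)) (S : Set ℝ) :=
    Set.disjoint_left.2 fun x hx => (hsub (Set.Ioo_subset_Icc_self hx)).2
  have := hS (t - δ) (t + δ) (by linarith) (fun x hx => interior_subset (hsub hx).1) hd
  exact (this.differentiableOn one_ne_zero).differentiableAt
    (Icc_mem_nhds (by linarith) (by linarith))

theorem integrableOn_comp_mul_deriv (hγ : PiecewiseC1On γ J) (hab : a ≤ b)
    (hJ : Set.Icc a b ⊆ J) {G : Set ℂ} {g : ℂ → ℂ} (hg : ContinuousOn g G)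
    (hG : ∀ t ∈ Set.Icc a b, γ t ∈ G) :
    IntegrableOn (fun t => g (γ t) * deriv γ t) (Set.Icc a b) :=
  (hγ.integrableOn_deriv hab hJ).continuousOn_mul (hg.comp (hγ.1.mono hJ) hG) isCompact_Icc

/-- The fundamental theorem of calculus along a piecewise continuously differentiable curve. -/
theorem integral_comp_mul_deriv (hγ : PiecewiseC1On γ J) (hab : a ≤ b)
    (hJ : Set.Icc a b ⊆ J) {G : Set ℂ} {X g : ℂ → ℂ} (hX : ∀ w ∈ G, HasDerivAt X (g w) w)
    (hG : ∀ t ∈ Set.Ioo a b, γ t ∈ G) (hXc : ContinuousOn (fun t => X (γ t)) (Set.Icc a b))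
    (hi : IntegrableOn (fun t => g (γ t) * deriv γ t) (Set.Icc a b)) :
    ∫ t in a..b, g (γ t) * deriv γ t = X (γ b) - X (γ a) := by
  obtain ⟨S, hS⟩ := hγ.exists_finset_differentiableAt
  refine integral_eq_of_hasDerivAt_off_countable_of_le (fun t => X (γ t)) _ hab
    S.countable_toSet hXc (fun t ht => ?_) ?_
  · have htJ : t ∈ interior J :=
      mem_interior_iff_mem_nhds.2 (mem_of_superset (Icc_mem_nhds ht.1.1 ht.1.2) hJ)
    exact (hX _ (hG t ht.1)).comp t (hS t htJ ht.2).hasDerivAt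
  · exact (intervalIntegrable_iff_integrableOn_Icc_of_le hab).2 hi

/-- Along a piece of a curve with slope bounded below, the integral of an integrand that decays
exponentially with the height is bounded independently of the length of the piece. -/
theorem integral_norm_le (hγ : PiecewiseC1On γ J) (hab : a ≤ b) (hJ : Set.Icc a b ⊆ J)
    {g : ℂ → ℂ} {M κ K σ Y : ℝ} (hκ : 0 < κ) (hM : 0 ≤ M)
    (hg : ∀ t ∈ Set.Icc a b, ‖g (γ t)‖ ≤ M * Real.exp (-κ * (γ t).im))
    (hY : ∀ t ∈ Set.Icc a b, Y ≤ (γ t).im)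
    (hK : ∀ t ∈ Set.Icc a b, ‖deriv γ t‖ ≤ K * (σ * (deriv γ t).im))
    (hi : IntegrableOn (fun t => g (γ t) * deriv γ t) (Set.Icc a b)) :
    ∫ t in a..b, ‖g (γ t) * deriv γ t‖ ≤ |K * σ * M / κ| * (2 * Real.exp (-κ * Y)) := by
  obtain ⟨S, hS⟩ := hγ.exists_finset_differentiableAt
  have him : ContinuousOn (fun t => (γ t).im) (Set.Icc a b) :=
    continuous_im.comp_continuousOn (hγ.1.mono hJ)
  have hec : ContinuousOn (fun t => Real.exp (-κ * (γ t).im)) (Set.Icc a b) := by fun_prop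
  have hdi : IntegrableOn (fun t => Real.exp (-κ * (γ t).im) * (deriv γ t).im) (Set.Icc a b) :=
    IntegrableOn.continuousOn_mul hec (hγ.integrableOn_deriv hab hJ).im isCompact_Icc
  have hdi' : IntegrableOn (fun t => K * σ * M * (Real.exp (-κ * (γ t).im) * (deriv γ t).im))
    (Set.Icc a b) := Integrable.const_mul hdi _
  have hle : ∫ t in a..b, ‖g (γ t) * deriv γ t‖ ≤
      ∫ t in a..b, K * σ * M * (Real.exp (-κ * (γ t).im) * (deriv γ t).im) := by
    refine intervalIntegral.integral_mono_on hab
      ((intervalIntegrable_iff_integrableOn_Icc_of_le hab).2 hi.norm)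
      ((intervalIntegrable_iff_integrableOn_Icc_of_le hab).2 hdi') fun t ht => ?_
    rw [norm_mul]
    calc _ ≤ M * Real.exp (-κ * (γ t).im) * (K * (σ * (deriv γ t).im)) :=
          mul_le_mul (hg t ht) (hK t ht) (norm_nonneg _) (by positivity)
      _ = _ := by ring
  -- The slope condition turns the arc length element into `± d Im γ`, so the bound is an exact
  -- derivative. The sign `σ` is `-1` on an incoming tail and `1` on an outgoing one.
  have heq : ∫ t in a..b, K * σ * M * (Real.exp (-κ * (γ t).im) * (deriv γ t).im) =
      (-(K * σ * M / κ) * Real.exp (-κ * (γ b).im)) -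
        (-(K * σ * M / κ) * Real.exp (-κ * (γ a).im)) := by
    refine integral_eq_of_hasDerivAt_off_countable_of_le
      (fun t => -(K * σ * M / κ) * Real.exp (-κ * (γ t).im)) _ hab
      S.countable_toSet (by fun_prop) (fun t ht => ?_)
      ((intervalIntegrable_iff_integrableOn_Icc_of_le hab).2 hdi')
    have htJ : t ∈ interior J :=
      mem_interior_iff_mem_nhds.2 (mem_of_superset (Icc_mem_nhds ht.1.1 ht.1.2) hJ)
    have h1 : HasDerivAt (fun t => (γ t).im) (deriv γ t).im t :=
      imCLM.hasFDerivAt.comp_hasDerivAt t (hS t htJ ht.2).hasDerivAt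
    refine ((h1.const_mul (-κ)).exp.const_mul (-(K * σ * M / κ))).congr_deriv ?_
    field_simp
  refine hle.trans (heq.le.trans ?_)
  have ha : Real.exp (-κ * (γ a).im) ≤ Real.exp (-κ * Y) :=
    Real.exp_le_exp.2 (by nlinarith [hY a (Set.left_mem_Icc.2 hab)])
  have hb : Real.exp (-κ * (γ b).im) ≤ Real.exp (-κ * Y) :=
    Real.exp_le_exp.2 (by nlinarith [hY b (Set.right_mem_Icc.2 hab)])
  calc _ = K * σ * M / κ * (Real.exp (-κ * (γ a).im) - Real.exp (-κ * (γ b).im)) := by ring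
    _ ≤ |K * σ * M / κ| * |Real.exp (-κ * (γ a).im) - Real.exp (-κ * (γ b).im)| := by
        rw [← abs_mul]; exact le_abs_self _
    _ ≤ _ := by
        gcongr
        rw [abs_le]
        constructor <;> nlinarith [Real.exp_pos (-κ * (γ a).im), Real.exp_pos (-κ * (γ b).im)]

/-- The bound of `integral_norm_le` depends on the lowest height `Y` and not on the length of the
piece, which is what integrability on the whole tail needs. -/
theorem integrableOn_Iic_of_tail (hγ : PiecewiseC1On γ J) {T : ℝ} (hJ : Set.Iic T ⊆ J)
    {G : Set ℂ} {g : ℂ → ℂ} (hgc : ContinuousOn g G) (hG : ∀ t ≤ T, γ t ∈ G)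
    {M κ K Y : ℝ} (hκ : 0 < κ) (hM : 0 ≤ M)
    (hg : ∀ t ≤ T, ‖g (γ t)‖ ≤ M * Real.exp (-κ * (γ t).im))
    (hY : ∀ t ≤ T, Y ≤ (γ t).im)
    (hK : ∀ t ≤ T, ‖deriv γ t‖ ≤ K * -(deriv γ t).im) :
    IntegrableOn (fun t => g (γ t) * deriv γ t) (Set.Iic T) := by
  have hint : ∀ a ≤ T, IntegrableOn (fun t => g (γ t) * deriv γ t) (Set.Icc a T) := fun a ha =>
    hγ.integrableOn_comp_mul_deriv ha (fun t ht => hJ ht.2) hgc fun t ht => hG t ht.2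
  refine integrableOn_Iic_of_intervalIntegral_norm_bounded (a := id) (l := atBot)
    (|K * (-1) * M / κ| * (2 * Real.exp (-κ * Y))) T (fun a => ?_) tendsto_id ?_
  · rcases le_total a T with h | h
    · exact (hint a h).mono_set Set.Ioc_subset_Icc_self
    · simp [Set.Ioc_eq_empty_of_le h]
  · filter_upwards [eventually_le_atBot T] with a ha
    exact hγ.integral_norm_le ha (fun t ht => hJ ht.2) hκ hM (fun t ht => hg t ht.2)
      (fun t ht => hY t ht.2) (fun t ht => by simpa using hK t ht.2) (hint a ha)

theorem integrableOn_Ioi_of_tail (hγ : PiecewiseC1On γ J) {T : ℝ} (hJ : Set.Ici T ⊆ J)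
    {G : Set ℂ} {g : ℂ → ℂ} (hgc : ContinuousOn g G) (hG : ∀ t ≥ T, γ t ∈ G)
    {M κ K Y : ℝ} (hκ : 0 < κ) (hM : 0 ≤ M)
    (hg : ∀ t ≥ T, ‖g (γ t)‖ ≤ M * Real.exp (-κ * (γ t).im))
    (hY : ∀ t ≥ T, Y ≤ (γ t).im)
    (hK : ∀ t ≥ T, ‖deriv γ t‖ ≤ K * (deriv γ t).im) :
    IntegrableOn (fun t => g (γ t) * deriv γ t) (Set.Ioi T) := by
  have hint : ∀ b ≥ T, IntegrableOn (fun t => g (γ t) * deriv γ t) (Set.Icc T b) := fun b hb =>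
    hγ.integrableOn_comp_mul_deriv hb (fun t ht => hJ ht.1) hgc fun t ht => hG t ht.1
  refine integrableOn_Ioi_of_intervalIntegral_norm_bounded (b := id) (l := atTop)
    (|K * 1 * M / κ| * (2 * Real.exp (-κ * Y))) T (fun b => ?_) tendsto_id ?_
  · rcases le_total T b with h | h
    · exact (hint b h).mono_set Set.Ioc_subset_Icc_self
    · simp [Set.Ioc_eq_empty_of_le h]
  · filter_upwards [eventually_ge_atTop T] with b hb
    exact hγ.integral_norm_le hb (fun t ht => hJ ht.1) hκ hM (fun t ht => hg t ht.1)
      (fun t ht => hY t ht.1) (fun t ht => by simpa using hK t ht.1) (hint b hb)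

end PiecewiseC1On

end BenjaminOno

/-! ### Size of the integrand far up and near a branch point. -/

noncomputable section

namespace BenjaminOno

/-- The function `h` with the cut of each logarithm at `z p` rotated: the argument of the `p`-th
logarithm is `s p * (w - z p)`. -/
def branch {P : ℕ} (lam : ℝ) (c z s : Fin P → ℂ) (w : ℂ) : ℂ :=
  lam * w + ∑ p, (c p * (log (s p * (w - z p)) + Real.pi * I / 2) +
    (starRingEnd ℂ) (c p) * (log (-I * (w - (starRingEnd ℂ) (z p))) - Real.pi * I / 2))

/-- The exponential factor of the integrand, for the given choice of branches. -/
def expFactor {P : ℕ} (ε lam : ℝ) (c z s : Fin P → ℂ) (w : ℂ) : ℂ :=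
  exp (-I * branch lam c z s w / ε)

/-- The rational factor of the integrand. -/
def poleSum {P : ℕ} (z φ : Fin P → ℂ) (w : ℂ) : ℂ := ∑ p, φ p / (w - z p)

/-- The domain on which `branch` is holomorphic. -/
def branchDomain {P : ℕ} (z s : Fin P → ℂ) : Set ℂ :=
  {w | ∀ p, s p * (w - z p) ∈ slitPlane ∧ -I * (w - (starRingEnd ℂ) (z p)) ∈ slitPlane}

variable {P : ℕ} {ε lam : ℝ} {c z φ s : Fin P → ℂ}

theorem integrand_eq (w : ℂ) :
    integrand ε lam c z φ w = expFactor ε lam c z (fun _ => I) w * poleSum z φ w := rfl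

theorem expFactor_ne_zero (w : ℂ) : expFactor ε lam c z s w ≠ 0 := exp_ne_zero _

theorem isOpen_branchDomain : IsOpen (branchDomain z s) := by
  have : branchDomain z s = ⋂ p, ((fun w => s p * (w - z p)) ⁻¹' slitPlane ∩
      (fun w => -I * (w - (starRingEnd ℂ) (z p))) ⁻¹' slitPlane) := by
    ext w
    simp [branchDomain]
  rw [this]
  exact isOpen_iInter_of_finite fun p => (isOpen_slitPlane.preimage (by fun_prop)).inter
    (isOpen_slitPlane.preimage (by fun_prop))

theorem differentiableAt_expFactor {w : ℂ} (hw : w ∈ branchDomain z s) :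
    DifferentiableAt ℂ (expFactor ε lam c z s) w := by
  unfold expFactor branch
  have h1 : ∀ p, DifferentiableAt ℂ (fun w => log (s p * (w - z p))) w := fun p =>
    DifferentiableAt.clog (by fun_prop) (hw p).1
  have h2 : ∀ p, DifferentiableAt ℂ (fun w => log (-I * (w - (starRingEnd ℂ) (z p)))) w := fun p =>
    DifferentiableAt.clog (by fun_prop) (hw p).2
  fun_prop

theorem sub_ne_zero_of_mem_branchDomain {w : ℂ} (hw : w ∈ branchDomain z s) (p : Fin P) :
    w - z p ≠ 0 := by
  intro h0
  have := (hw p).1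
  rw [h0, mul_zero] at this
  exact zero_notMem_slitPlane this

theorem differentiableAt_poleSum {w : ℂ} (hw : ∀ p, w - z p ≠ 0) :
    DifferentiableAt ℂ (poleSum z φ) w := by
  unfold poleSum
  have h1 : ∀ p, DifferentiableAt ℂ (fun w => φ p / (w - z p)) w := fun p =>
    DifferentiableAt.div (by fun_prop) (by fun_prop) (hw p)
  fun_prop

theorem differentiableOn_expFactor_mul_poleSum :
    DifferentiableOn ℂ (fun w => expFactor ε lam c z s w * poleSum z φ w) (branchDomain z s) :=
  fun _ hw => ((differentiableAt_expFactor hw).mul (differentiableAt_poleSum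
    (sub_ne_zero_of_mem_branchDomain hw))).differentiableWithinAt

/-- The shifts `± π i / 2` cancel between conjugate terms. What remains is a linear term, arguments
that are bounded whatever the cuts, and logarithms of moduli that do not depend on the cuts. -/
theorem norm_expFactor (hs : ∀ p, ‖s p‖ = 1) (w : ℂ) :
    ‖expFactor ε lam c z s w‖ = Real.exp ((lam * w.im +
      ∑ p, ((c p).re * (arg (s p * (w - z p)) + arg (-I * (w - (starRingEnd ℂ) (z p)))) +
        (c p).im * (Real.log ‖w - z p‖ - Real.log ‖w - (starRingEnd ℂ) (z p)‖))) / ε) := by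
  rw [expFactor, norm_exp]
  congr 1
  have h1 : (-I * branch lam c z s w / ε).re = (branch lam c z s w).im / ε := by
    rw [div_ofReal_re]; simp
  rw [h1, branch, add_im, im_sum]
  congr 2
  · simp
  · refine Finset.sum_congr rfl fun p _ => ?_
    have e1 : ‖s p * (w - z p)‖ = ‖w - z p‖ := by rw [norm_mul, hs, one_mul]
    have e2 : ‖-I * (w - (starRingEnd ℂ) (z p))‖ = ‖w - (starRingEnd ℂ) (z p)‖ := by simp
    simp only [add_im, mul_im, conj_re, conj_im, sub_re, sub_im, add_re, log_re, log_im, e1, e2]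
    have e3 : ((Real.pi : ℂ) * I / 2).re = 0 := by simp
    have e4 : ((Real.pi : ℂ) * I / 2).im = Real.pi / 2 := by simp
    rw [e3, e4]
    ring

/-- The contribution of the arguments of the logarithms to `log ‖expFactor‖` is bounded. -/
theorem abs_sum_arg_le (w : ℂ) :
    |∑ p, (c p).re * (arg (s p * (w - z p)) + arg (-I * (w - (starRingEnd ℂ) (z p))))| ≤
      ∑ p, |(c p).re| * (2 * Real.pi) := by
  refine (Finset.abs_sum_le_sum_abs _ _).trans (Finset.sum_le_sum fun p _ => ?_)
  rw [abs_mul]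
  refine mul_le_mul_of_nonneg_left ((abs_add_le _ _).trans ?_) (abs_nonneg _)
  linarith [abs_arg_le_pi (s p * (w - z p)), abs_arg_le_pi (-I * (w - (starRingEnd ℂ) (z p)))]

/-- In the upper half-plane and at distance at least `δ` from the poles, `‖w - conj z_p‖ / ‖w -
z_p‖` lies between `1` and `1 + 2 Im z_p / δ`. Only the linear term of the exponent is then
unbounded. The constant serves all choices `s` of cuts at once. -/
theorem exists_norm_expFactor_le (hε : 0 < ε) (hz : ∀ p, 0 < (z p).im) {δ : ℝ} (hδ : 0 < δ) :
    ∃ M : ℝ, 0 < M ∧ ∀ s : Fin P → ℂ, (∀ p, ‖s p‖ = 1) → ∀ w : ℂ, 0 ≤ w.im →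
      (∀ p, δ ≤ ‖w - z p‖) →
      ‖expFactor ε lam c z s w‖ ≤ M * Real.exp (-(-lam / ε) * w.im) := by
  refine ⟨Real.exp ((∑ p, |(c p).re| * (2 * Real.pi) +
    ∑ p, |(c p).im| * Real.log (1 + 2 * (z p).im / δ)) / ε), Real.exp_pos _, ?_⟩
  intro s hs w hw hd
  rw [norm_expFactor hs, ← Real.exp_add, Real.exp_le_exp, Finset.sum_add_distrib]
  have h1 := (abs_le.1 (abs_sum_arg_le (c := c) (z := z) (s := s) w)).2
  have h2 : ∑ p, (c p).im * (Real.log ‖w - z p‖ - Real.log ‖w - (starRingEnd ℂ) (z p)‖) ≤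
      ∑ p, |(c p).im| * Real.log (1 + 2 * (z p).im / δ) := by
    refine Finset.sum_le_sum fun p _ => ?_
    refine (le_abs_self _).trans ?_
    rw [abs_mul]
    refine mul_le_mul_of_nonneg_left ?_ (abs_nonneg _)
    have hpos : 0 < ‖w - z p‖ := hδ.trans_le (hd p)
    have hle : ‖w - z p‖ ≤ ‖w - (starRingEnd ℂ) (z p)‖ := by
      rw [norm_def, norm_def]
      refine Real.sqrt_le_sqrt ?_
      simp only [normSq_apply, sub_re, sub_im, conj_re, conj_im]
      nlinarith [mul_nonneg hw (hz p).le]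
    have hle2 : ‖w - (starRingEnd ℂ) (z p)‖ ≤ (1 + 2 * (z p).im / δ) * ‖w - z p‖ := by
      have e : w - (starRingEnd ℂ) (z p) = (w - z p) + (z p - (starRingEnd ℂ) (z p)) := by ring
      have e2 : ‖z p - (starRingEnd ℂ) (z p)‖ = 2 * (z p).im := by
        rw [sub_conj]
        simp [abs_of_pos (hz p)]
      have e3 : 2 * (z p).im ≤ 2 * (z p).im / δ * ‖w - z p‖ := by
        rw [div_mul_eq_mul_div, le_div_iff₀ hδ]
        exact mul_le_mul_of_nonneg_left (hd p) (by linarith [hz p])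
      calc _ ≤ ‖w - z p‖ + ‖z p - (starRingEnd ℂ) (z p)‖ := by rw [e]; exact norm_add_le _ _
        _ ≤ _ := by rw [e2]; linarith
    have l1 := Real.log_le_log hpos hle
    have hc0 : 0 < 1 + 2 * (z p).im / δ := by have := hz p; positivity
    have l2 := Real.log_le_log (hpos.trans_le hle) hle2
    rw [Real.log_mul hc0.ne' hpos.ne'] at l2
    rw [abs_le]
    constructor <;> linarith
  have : (lam * w.im + (∑ p, (c p).re * (arg (s p * (w - z p)) +
      arg (-I * (w - (starRingEnd ℂ) (z p)))) +
      ∑ p, (c p).im * (Real.log ‖w - z p‖ - Real.log ‖w - (starRingEnd ℂ) (z p)‖))) / ε ≤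
      (lam * w.im + (∑ p, |(c p).re| * (2 * Real.pi) +
        ∑ p, |(c p).im| * Real.log (1 + 2 * (z p).im / δ))) / ε := by
    gcongr
  exact this.trans (le_of_eq (by ring))

theorem norm_poleSum_le {w : ℂ} {δ : ℝ} (hδ : 0 < δ) (h : ∀ p, δ ≤ ‖w - z p‖) :
    ‖poleSum z φ w‖ ≤ (∑ p, ‖φ p‖) / δ := by
  rw [Finset.sum_div]
  refine norm_sum_le_of_le _ fun p _ => ?_
  rw [norm_div]
  exact div_le_div_of_nonneg_left (norm_nonneg _) hδ (h p)

/-- `r` is a radius so small that the other poles, and the real axis, are far from the disc of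
radius `r` around `z m`. -/
structure IsIsolatingRadius (z : Fin P → ℂ) (m : Fin P) (r : ℝ) : Prop where
  pos : 0 < r
  lt_im : r < (z m).im
  lt_re : ∀ p ≠ m, 2 * r < |(z p).re - (z m).re|

theorem exists_isIsolatingRadius (hz : ∀ p, 0 < (z p).im) (hre : StrictMono fun p => (z p).re)
    (m : Fin P) : ∃ r, IsIsolatingRadius z m r := by
  have h1 : ∀ᶠ r : ℝ in 𝓝[>] 0, r < (z m).im :=
    nhdsWithin_le_nhds (Iio_mem_nhds (hz m))
  have h2 : ∀ᶠ r : ℝ in 𝓝[>] 0, ∀ p ≠ m, 2 * r < |(z p).re - (z m).re| := by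
    rw [eventually_all]
    intro p
    by_cases hp : p = m
    · simp [hp]
    have : 0 < |(z p).re - (z m).re| := abs_pos.2 (sub_ne_zero.2 (hre.injective.ne hp))
    filter_upwards [nhdsWithin_le_nhds (Iio_mem_nhds (half_pos this))] with r hr _
    have : r < _ := hr
    linarith
  obtain ⟨r, ⟨ha, hb⟩, hc⟩ := ((h1.and h2).and self_mem_nhdsWithin).exists
  exact ⟨r, hc, ha, hb⟩

/-- In the logarithm of the norm, the one term singular at `z m` is `(Im c_m / ε) log ‖w - z m‖`;
the others are continuous on the closed disc or are bounded arguments. -/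
theorem exists_norm_expFactor_near (hε : 0 < ε) (hz : ∀ p, 0 < (z p).im) {m : Fin P} {r : ℝ}
    (hr : IsIsolatingRadius z m r) :
    ∃ C : ℝ, 0 < C ∧ ∀ s : Fin P → ℂ, (∀ p, ‖s p‖ = 1) → ∀ w : ℂ, w ≠ z m → ‖w - z m‖ ≤ r →
      ‖expFactor ε lam c z s w‖ ≤ C * ‖w - z m‖ ^ ((c m).im / ε) ∧
      ‖w - z m‖ ^ ((c m).im / ε) ≤ C * ‖expFactor ε lam c z s w‖ := by
  -- The exponent without its arguments and without the singular term; it is bounded by compactness.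
  set B : ℂ → ℝ := fun w => lam * w.im + ∑ p, ((if p = m then 0 else
    (c p).im * Real.log ‖w - z p‖) - (c p).im * Real.log ‖w - (starRingEnd ℂ) (z p)‖) with hB
  have hBc : ContinuousOn B (Metric.closedBall (z m) r) := by
    intro w hw
    rw [mem_closedBall_iff_norm] at hw
    have him : 0 < w.im := by
      have := (abs_le.1 ((abs_im_le_norm (w - z m)).trans hw)).1
      have := hr.lt_im
      rw [sub_im] at *
      linarith
    have h1 : ∀ p, p ≠ m → ContinuousAt (fun w : ℂ => Real.log ‖w - z p‖) w := by
      intro p hp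
      refine ContinuousAt.log (by fun_prop) (norm_ne_zero_iff.2 (sub_ne_zero.2 ?_))
      rintro rfl
      have h2 := (abs_re_le_norm (z p - z m)).trans hw
      have h3 := hr.lt_re p hp
      rw [sub_re] at h2
      linarith [hr.pos]
    have h2 : ∀ p, ContinuousAt (fun w : ℂ => Real.log ‖w - (starRingEnd ℂ) (z p)‖) w := by
      intro p
      refine ContinuousAt.log (by fun_prop) (norm_ne_zero_iff.2 (sub_ne_zero.2 ?_))
      rintro rfl
      rw [conj_im] at him
      linarith [hz p]
    refine ContinuousAt.continuousWithinAt ?_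
    refine ContinuousAt.add (by fun_prop) (tendsto_finsetSum _ fun p _ => ?_)
    refine ContinuousAt.sub ?_ (continuousAt_const.mul (h2 p))
    by_cases hp : p = m
    · simp only [hp, if_true]; exact continuousAt_const
    · simp only [hp, if_false]; exact continuousAt_const.mul (h1 p hp)
  obtain ⟨D, hD⟩ := (isCompact_closedBall (z m) r).exists_bound_of_continuousOn hBc
  set A : ℝ := ∑ p, |(c p).re| * (2 * Real.pi) with hA
  refine ⟨Real.exp ((D + A) / ε), Real.exp_pos _, fun s hs w hwm hw => ?_⟩
  have hupos : 0 < ‖w - z m‖ := norm_pos_iff.2 (sub_ne_zero.2 hwm)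
  have hDw := hD w (mem_closedBall_iff_norm.2 hw)
  rw [Real.norm_eq_abs] at hDw
  have hAw := abs_sum_arg_le (c := c) (z := z) (s := s) w
  set a : ℝ := ∑ p, (c p).re * (arg (s p * (w - z p)) + arg (-I * (w - (starRingEnd ℂ) (z p))))
    with ha
  have hsum : lam * w.im + ∑ p, ((c p).re * (arg (s p * (w - z p)) +
      arg (-I * (w - (starRingEnd ℂ) (z p)))) +
        (c p).im * (Real.log ‖w - z p‖ - Real.log ‖w - (starRingEnd ℂ) (z p)‖)) =
      B w + a + (c m).im * Real.log ‖w - z m‖ := by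
    have e : (c m).im * Real.log ‖w - z m‖ =
        ∑ p, if p = m then (c p).im * Real.log ‖w - z p‖ else 0 := by simp
    rw [e, hB, ha]
    simp only
    rw [add_assoc, add_assoc, ← Finset.sum_add_distrib, ← Finset.sum_add_distrib]
    congr 1
    refine Finset.sum_congr rfl fun p _ => ?_
    split_ifs <;> ring
  rw [norm_expFactor hs, hsum, Real.rpow_def_of_pos hupos, ← Real.exp_add, ← Real.exp_add,
    Real.exp_le_exp, Real.exp_le_exp]
  have e1 := abs_le.1 hDw
  have e2 := abs_le.1 hAw
  constructor
  · have : (B w + a + (c m).im * Real.log ‖w - z m‖) / ε ≤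
        (D + A + (c m).im * Real.log ‖w - z m‖) / ε := by
      gcongr
      · exact e1.2
      · exact e2.2
    refine this.trans (le_of_eq (by ring))
  · have : (-D + -A + (c m).im * Real.log ‖w - z m‖) / ε ≤
        (B w + a + (c m).im * Real.log ‖w - z m‖) / ε := by
      gcongr
      · exact e1.1
      · exact e2.1
    have e3 : (-D + -A + (c m).im * Real.log ‖w - z m‖) / ε =
      Real.log ‖w - z m‖ * ((c m).im / ε) - (D + A) / ε := by ring
    linarith

/-- Since `z m` is the nearest pole, `norm_poleSum_le` applies with `δ = ‖w - z m‖`. -/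
theorem IsIsolatingRadius.norm_sub_le {m : Fin P} {r : ℝ} (hr : IsIsolatingRadius z m r) {w : ℂ}
    (hw : ‖w - z m‖ ≤ r) (p : Fin P) : ‖w - z m‖ ≤ ‖w - z p‖ := by
  by_cases hp : p = m
  · rw [hp]
  have h1 := hr.lt_re p hp
  have h2 : |(z p).re - (z m).re| ≤ ‖z p - z m‖ := by simpa using abs_re_le_norm (z p - z m)
  have h3 : ‖z p - z m‖ ≤ ‖w - z m‖ + ‖w - z p‖ := by
    have : z p - z m = (w - z m) - (w - z p) := by ring
    rw [this]; exact _root_.norm_sub_le _ _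
  linarith

/-- The order of growth of the integrand near `z m`. -/
theorem exists_norm_integrand_near (hε : 0 < ε) (hz : ∀ p, 0 < (z p).im) {m : Fin P} {r : ℝ}
    (hr : IsIsolatingRadius z m r) :
    ∃ C : ℝ, 0 < C ∧ ∀ w : ℂ, w ≠ z m → ‖w - z m‖ ≤ r →
      ‖integrand ε lam c z φ w‖ ≤ C * ‖w - z m‖ ^ ((c m).im / ε - 1) := by
  obtain ⟨C, hC, h⟩ := exists_norm_expFactor_near (lam := lam) (c := c) hε hz hr
  have hφ : 0 ≤ ∑ p, ‖φ p‖ := Finset.sum_nonneg fun p _ => norm_nonneg _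
  -- The summand `1` keeps the constant positive when all `φ p` vanish.
  refine ⟨C * (∑ p, ‖φ p‖ + 1), by positivity, fun w hwm hw => ?_⟩
  have hupos : 0 < ‖w - z m‖ := norm_pos_iff.2 (sub_ne_zero.2 hwm)
  rw [integrand_eq, norm_mul, Real.rpow_sub_one hupos.ne']
  have h1 := (h (fun _ => I) (by simp) w hwm hw).1
  have h2 := norm_poleSum_le (φ := φ) hupos (hr.norm_sub_le hw)
  calc _ ≤ C * ‖w - z m‖ ^ ((c m).im / ε) * ((∑ p, ‖φ p‖) / ‖w - z m‖) :=
        mul_le_mul h1 h2 (norm_nonneg _) (by positivity)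
    _ ≤ C * ‖w - z m‖ ^ ((c m).im / ε) * ((∑ p, ‖φ p‖ + 1) / ‖w - z m‖) := by
        gcongr; linarith
    _ = _ := by ring

theorem exists_norm_expFactor_mul_poleSum_le (hε : 0 < ε) (hz : ∀ p, 0 < (z p).im) :
    ∃ M Y : ℝ, 0 < M ∧ 0 < Y ∧ (∀ p, (z p).im + 1 < Y) ∧ ∀ s : Fin P → ℂ, (∀ p, ‖s p‖ = 1) →
      ∀ w : ℂ, Y < w.im →
      ‖expFactor ε lam c z s w * poleSum z φ w‖ ≤ M * Real.exp (-(-lam / ε) * w.im) := by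
  obtain ⟨M, hM, h⟩ := exists_norm_expFactor_le (lam := lam) (c := c) hε hz one_pos
  have hY : ∀ p, (z p).im + 1 < ∑ p, (z p).im + 2 := fun p => by
    have := Finset.single_le_sum (f := fun p => (z p).im) (fun q _ => (hz q).le) (Finset.mem_univ p)
    linarith
  have hY0 : 0 < ∑ p, (z p).im + 2 := by
    have := Finset.sum_nonneg (s := Finset.univ) fun p _ => (hz p).le
    linarith
  have hφ : 0 ≤ ∑ p, ‖φ p‖ := Finset.sum_nonneg fun p _ => norm_nonneg _
  refine ⟨M * (∑ p, ‖φ p‖ + 1), ∑ p, (z p).im + 2, by positivity, hY0, hY, fun s hs w hw => ?_⟩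
  have hd : ∀ p, 1 ≤ ‖w - z p‖ := fun p => by
    have h1 := (le_abs_self _).trans (abs_im_le_norm (w - z p))
    rw [sub_im] at h1
    linarith [hY p]
  rw [norm_mul]
  calc _ ≤ M * Real.exp (-(-lam / ε) * w.im) * ((∑ p, ‖φ p‖) / 1) :=
        mul_le_mul (h s hs w (by linarith) hd) (norm_poleSum_le one_pos hd) (norm_nonneg _)
          (by positivity)
    _ ≤ M * Real.exp (-(-lam / ε) * w.im) * (∑ p, ‖φ p‖ + 1) := by
        rw [div_one]; gcongr; linarith
    _ = _ := by ring

end BenjaminOno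

end

/-! ### The primitive of the integrand on `G` and its limits at `i∞`. -/

noncomputable section

namespace BenjaminOno

variable {P : ℕ} {ε lam : ℝ} {c z φ s : Fin P → ℂ}

theorem mem_domainG_iff {w : ℂ} :
    w ∈ domainG z ↔ ∀ p, w.re = (z p).re → |w.im| < (z p).im := by
  simp only [domainG, Set.mem_ofPred_eq, mem_slitPlane_iff]
  refine forall_congr' fun p => ?_
  simp only [mul_re, I_re, sub_re, zero_mul, I_im, sub_im, one_mul, zero_sub, mul_im, zero_add,
    neg_re, neg_im, conj_re, conj_im, neg_mul, sub_neg_eq_add, abs_lt]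
  constructor
  · rintro ⟨h1, h2⟩ h
    rw [h] at h1 h2
    simp only [sub_self, ne_eq, not_true_eq_false, or_false, neg_zero] at h1 h2
    constructor <;> linarith
  · intro h
    by_cases hre : w.re = (z p).re
    · obtain ⟨h1, h2⟩ := h hre
      exact ⟨Or.inl (by linarith), Or.inl (by linarith)⟩
    · exact ⟨Or.inr (sub_ne_zero.2 hre), Or.inr (neg_ne_zero.2 (sub_ne_zero.2 hre))⟩

theorem isOpen_domainG : IsOpen (domainG z) := isOpen_branchDomain (s := fun _ => I)

/-- The cuts are vertical, so a small step to the right leaves them. This gives density of `G` and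
approach to any point from inside `G`. -/
theorem eventually_add_mem_domainG (w : ℂ) : ∀ᶠ t : ℝ in 𝓝[>] 0, w + t ∈ domainG z := by
  simp only [mem_domainG_iff]
  rw [eventually_all]
  intro p
  rcases lt_or_ge w.re (z p).re with h | h
  · filter_upwards [nhdsWithin_le_nhds (Iio_mem_nhds (sub_pos.2 h))] with t ht h'
    have : t < _ := ht
    simp only [add_re, ofReal_re] at h'
    linarith
  · filter_upwards [self_mem_nhdsWithin] with t ht h'
    have : 0 < t := ht
    simp only [add_re, ofReal_re] at h'
    linarith

theorem dense_domainG : Dense (domainG z) := fun w => by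
  refine mem_closure_of_tendsto (f := fun t : ℝ => w + t) (b := 𝓝[>] 0) ?_
    (eventually_add_mem_domainG w)
  have : ContinuousAt (fun t : ℝ => w + t) 0 := by fun_prop
  simpa [ContinuousAt] using this.tendsto.mono_left nhdsWithin_le_nhds

theorem column_subset_domainG (k : ℕ) : column z k ⊆ domainG z := by
  intro w hw
  rw [mem_domainG_iff]
  intro p hp
  rcases lt_or_ge p.val k with h | h
  · exact absurd hp ((hw p).1 h).ne'
  · exact absurd hp ((hw p).2 h).ne

theorem ofReal_mem_domainG (hz : ∀ p, 0 < (z p).im) (x : ℝ) : (x : ℂ) ∈ domainG z :=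
  mem_domainG_iff.2 fun p _ => by simpa using hz p

theorem differentiableOn_integrand : DifferentiableOn ℂ (integrand ε lam c z φ) (domainG z) :=
  differentiableOn_expFactor_mul_poleSum (s := fun _ => I)

/-- The primitive of the integrand on `G` that vanishes at `0`. -/
def primitive {P : ℕ} (ε lam : ℝ) (c z φ : Fin P → ℂ) (w : ℂ) : ℂ :=
  wedgeIntegral 0 w (integrand ε lam c z φ)

/-- `G` contains the real axis and, with each point, the vertical segment down or up to that axis,
so it contains every wedge path from `0`. -/
theorem hasDerivAt_primitive (hz : ∀ p, 0 < (z p).im) {w : ℂ} (hw : w ∈ domainG z) :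
    HasDerivAt (primitive ε lam c z φ) (integrand ε lam c z φ w) w := by
  refine hasDerivAt_wedgeIntegral_of_wedge_subset isOpen_domainG ?_ ?_
    differentiableOn_integrand hw
  · intro x _ s _
    simpa using ofReal_mem_domainG hz s
  · intro x hx t ht
    rw [mem_domainG_iff] at hx ⊢
    intro p hp
    have h1 : |x.im| < (z p).im := hx p (by simpa using hp)
    have h2 : |t| ≤ |x.im| := by
      have := Set.abs_sub_left_of_mem_uIcc ht
      simpa using this
    simpa using h2.trans_lt h1

/-- Above height `Y` each column is a half-strip inside `G` on which the integrand decays like `exp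
(lam * Im w / ε)`, so `exists_limit_of_deriv_exp_decay` applies to each column. -/
theorem exists_column_limit (hε : 0 < ε) (hlam : lam < 0) (hz : ∀ p, 0 < (z p).im) :
    ∃ (L : ℕ → ℂ) (C Y : ℝ), 0 < Y ∧ (∀ p, (z p).im + 1 < Y) ∧ ∀ k, ∀ w ∈ column z k, Y < w.im →
      ‖primitive ε lam c z φ w - L k‖ ≤ C * Real.exp (-(-lam / ε) * w.im) := by
  obtain ⟨M, Y, hM, hY0, hY, hb⟩ :=
    exists_norm_expFactor_mul_poleSum_le (lam := lam) (c := c) (φ := φ) hε hz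
  have hκ : 0 < -lam / ε := div_pos (neg_pos.2 hlam) hε
  set J : ℕ → Set ℝ := fun k => {x | ∀ p : Fin P, (p.val < k → (z p).re < x) ∧
    (k ≤ p.val → x < (z p).re)} with hJ
  have hJo : ∀ k, (J k).OrdConnected := fun k => ⟨fun a ha b hb x hx p =>
    ⟨fun h => ((ha p).1 h).trans_le hx.1, fun h => hx.2.trans_lt ((hb p).2 h)⟩⟩
  have := fun k => exists_limit_of_deriv_exp_decay (X := primitive ε lam c z φ)
    (g := integrand ε lam c z φ) (hJo k) (Y₀ := Y) hκ
    (fun w hw _ => hasDerivAt_primitive hz (column_subset_domainG k hw))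
    (fun w hw hi => hb (fun _ => I) (by simp) w hi)
  choose L hL using this
  exact ⟨L, _, Y, hY0, hY, fun k w hw hi => hL k w hw hi⟩

theorem tendsto_exp_neg_mul {κ : ℝ} (hκ : 0 < κ) (C : ℝ) :
    Tendsto (fun y : ℝ => C * Real.exp (-κ * y)) atTop (𝓝 0) := by
  have : Tendsto (fun y : ℝ => Real.exp (-κ * y)) atTop (𝓝 0) :=
    Real.tendsto_exp_atBot.comp (tendsto_id.const_mul_atTop_of_neg (by linarith))
  simpa using this.const_mul C

/-- Along the negative real axis the primitive tends to its limit at `i∞` in the leftmost column. -/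
theorem tendsto_primitive_neg (hε : 0 < ε) (hlam : lam < 0) (hz : ∀ p, 0 < (z p).im)
    {L : ℕ → ℂ} {C Y : ℝ} (hL : ∀ k, ∀ w ∈ column z k, Y < w.im →
      ‖primitive ε lam c z φ w - L k‖ ≤ C * Real.exp (-(-lam / ε) * w.im)) :
    Tendsto (fun A : ℝ => primitive ε lam c z φ (-A : ℝ)) atTop (𝓝 (L 0)) := by
  obtain ⟨M, hM, hb⟩ := exists_norm_expFactor_le (lam := lam) (c := c) hε hz one_pos
  have hκ : 0 < -lam / ε := div_pos (neg_pos.2 hlam) hε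
  set κ := -lam / ε with hκd
  set R : ℝ := ∑ p, |(z p).re| with hR
  have hRp : ∀ p, |(z p).re| ≤ R := fun p =>
    Finset.single_le_sum (f := fun p => |(z p).re|) (fun q _ => abs_nonneg _) (Finset.mem_univ p)
  -- On the line `Re w = -A` all poles are at distance at least `A - R`. Integrating up this line
  -- from height `0` to `i∞` therefore costs only `O(1 / (A - R))`.
  have hbound : ∀ A : ℝ, R + 1 < A →
      ‖primitive ε lam c z φ (-A : ℝ) - L 0‖ ≤ M * ((∑ p, ‖φ p‖) / (A - R)) / κ := by
    intro A hA
    have hcol : ∀ y : ℝ, ((-A : ℝ) + y * I : ℂ) ∈ column z 0 := by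
      intro y p
      refine ⟨fun h => absurd h (Nat.not_lt_zero _), fun _ => ?_⟩
      have := (abs_le.1 (hRp p)).1
      simp
      linarith
    have hdist : ∀ w : ℂ, w.re = -A → ∀ p, A - R ≤ ‖w - z p‖ := by
      intro w hw p
      have h1 := (neg_abs_le _).trans (le_refl (w - z p).re) |> neg_le.1
      have h2 := h1.trans (abs_re_le_norm (w - z p))
      rw [sub_re, hw] at h2
      have := (abs_le.1 (hRp p)).1
      linarith
    obtain ⟨L', hL'⟩ := exists_limit_of_deriv_exp_decay (X := primitive ε lam c z φ)
      (g := integrand ε lam c z φ) (J := {-A}) Set.ordConnected_singleton (Y₀ := 0)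
      (M := M * ((∑ p, ‖φ p‖) / (A - R))) hκ
      (fun w hw _ => hasDerivAt_primitive hz (column_subset_domainG 0 (by
        have hw' : w.re = -A := hw
        have := hcol w.im
        rwa [← hw', re_add_im] at this)))
      (fun w hw hi => by
        have hd := hdist w hw
        rw [integrand_eq, norm_mul]
        calc _ ≤ M * Real.exp (-κ * w.im) * ((∑ p, ‖φ p‖) / (A - R)) :=
              mul_le_mul (hb _ (by simp) w hi.le fun p => by linarith [hd p])
                (norm_poleSum_le (by linarith) hd) (norm_nonneg _) (by positivity)
          _ = _ := by ring)
    have hXL : Tendsto (fun y : ℝ => primitive ε lam c z φ ((-A : ℝ) + y * I)) atTop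
        (𝓝 (L 0)) := by
      rw [tendsto_iff_norm_sub_tendsto_zero]
      refine squeeze_zero' (Eventually.of_forall fun _ => norm_nonneg _) ?_
        (tendsto_exp_neg_mul hκ C)
      filter_upwards [eventually_gt_atTop Y] with y hy
      simpa using hL 0 _ (hcol y) (by simpa using hy)
    have hXL' : Tendsto (fun y : ℝ => primitive ε lam c z φ ((-A : ℝ) + y * I)) atTop
        (𝓝 L') := by
      rw [tendsto_iff_norm_sub_tendsto_zero]
      refine squeeze_zero' (Eventually.of_forall fun _ => norm_nonneg _) ?_
        (tendsto_exp_neg_mul hκ (M * ((∑ p, ‖φ p‖) / (A - R)) / κ))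
      filter_upwards [eventually_gt_atTop 0] with y hy
      simpa using hL' ((-A : ℝ) + y * I) (by simp) (by simpa using hy)
    obtain rfl := tendsto_nhds_unique hXL hXL'
    -- The estimate is available at positive heights only and is carried to the real axis by
    -- continuity.
    have hcont : ContinuousAt (fun y : ℝ => primitive ε lam c z φ ((-A : ℝ) + y * I)) 0 := by
      have h1 : ContinuousAt (primitive ε lam c z φ) ((-A : ℝ) + (0 : ℝ) * I) :=
        (hasDerivAt_primitive hz (column_subset_domainG 0 (hcol 0))).continuousAt
      exact ContinuousAt.comp (f := fun y : ℝ => ((-A : ℝ) + y * I : ℂ)) h1 (by fun_prop)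
    have h1 : Tendsto (fun y : ℝ => ‖primitive ε lam c z φ ((-A : ℝ) + y * I) - L 0‖) (𝓝[>] 0)
        (𝓝 ‖primitive ε lam c z φ (-A : ℝ) - L 0‖) := by
      have := ((hcont.tendsto.sub_const (L 0)).norm).mono_left
        (nhdsWithin_le_nhds (s := Set.Ioi 0))
      simpa using this
    have h2 : Tendsto (fun y : ℝ => M * ((∑ p, ‖φ p‖) / (A - R)) / κ * Real.exp (-κ * y)) (𝓝[>] 0)
        (𝓝 (M * ((∑ p, ‖φ p‖) / (A - R)) / κ)) := by
      have : ContinuousAt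
        (fun y : ℝ => M * ((∑ p, ‖φ p‖) / (A - R)) / κ * Real.exp (-κ * y)) 0 := by fun_prop
      simpa using this.tendsto.mono_left (nhdsWithin_le_nhds (s := Set.Ioi 0))
    refine le_of_tendsto_of_tendsto h1 h2 ?_
    filter_upwards [self_mem_nhdsWithin] with y hy
    have hy' : 0 < y := hy
    simpa using hL' ((-A : ℝ) + y * I) (by simp) (by simpa using hy')
  rw [tendsto_iff_norm_sub_tendsto_zero]
  refine squeeze_zero' (Eventually.of_forall fun _ => norm_nonneg _)
    ((eventually_gt_atTop (R + 1)).mono hbound) ?_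
  have h1 : Tendsto (fun A : ℝ => A - R) atTop atTop := tendsto_atTop_add_const_right _ _ tendsto_id
  have h2 := ((h1.const_div_atTop (∑ p, ‖φ p‖)).const_mul M).div_const κ
  simpa using h2

theorem primitive_ofReal (x : ℝ) :
    primitive ε lam c z φ x = ∫ s in (0 : ℝ)..x, integrand ε lam c z φ (s : ℂ) := by
  simp [primitive, wedgeIntegral]

theorem integral_neg_eq_primitive_sub (hz : ∀ p, 0 < (z p).im) (A x : ℝ) :
    ∫ s in (-A)..x, integrand ε lam c z φ (s : ℂ) =
      primitive ε lam c z φ x - primitive ε lam c z φ (-A : ℝ) := by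
  have hc : Continuous fun s : ℝ => integrand ε lam c z φ (s : ℂ) :=
    continuous_iff_continuousAt.2 fun s =>
      ContinuousAt.comp (f := fun s : ℝ => (s : ℂ))
        (differentiableOn_integrand.continuousOn.continuousAt
          (isOpen_domainG.mem_nhds (ofReal_mem_domainG hz s))) (by fun_prop)
  rw [primitive_ofReal, primitive_ofReal, intervalIntegral.integral_interval_sub_left
    (hc.intervalIntegrable _ _) (hc.intervalIntegrable _ _)]

theorem integralFromNegInfty_eq (hz : ∀ p, 0 < (z p).im) {L₀ : ℂ}
    (h : Tendsto (fun A : ℝ => primitive ε lam c z φ (-A : ℝ)) atTop (𝓝 L₀)) (w : ℂ) :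
    integralFromNegInfty ε lam c z φ w = primitive ε lam c z φ w - L₀ := by
  have h1 : Tendsto (fun A : ℝ => ∫ s in (-A)..w.re, integrand ε lam c z φ (s : ℂ)) atTop
      (𝓝 (primitive ε lam c z φ w.re - L₀)) := by
    simp only [integral_neg_eq_primitive_sub hz]
    exact h.const_sub _
  rw [integralFromNegInfty, h1.limUnder_eq, primitive_ofReal, primitive, wedgeIntegral,
    intervalIntegral.integral_mul_const]
  simp
  ring

/-- The properties of the contour integral from `-∞`: it is a primitive of the integrand, and it
tends to limits at `i∞` in the columns, the first of which is zero. -/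
theorem exists_column_limit_integralFromNegInfty (hε : 0 < ε) (hlam : lam < 0)
    (hz : ∀ p, 0 < (z p).im) :
    (∀ x : ℝ, ∃ L : ℂ, Tendsto
      (fun A : ℝ => ∫ s in (-A)..x, integrand ε lam c z φ (s : ℂ)) atTop (𝓝 L)) ∧
    (∀ w ∈ domainG z, HasDerivAt (integralFromNegInfty ε lam c z φ) (integrand ε lam c z φ w) w) ∧
    ∃ (L : ℕ → ℂ) (C Y : ℝ), L 0 = 0 ∧ 0 < Y ∧ (∀ p, (z p).im + 1 < Y) ∧
      ∀ k, ∀ w ∈ column z k, Y < w.im →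
        ‖integralFromNegInfty ε lam c z φ w - L k‖ ≤ C * Real.exp (-(-lam / ε) * w.im) := by
  obtain ⟨L, C, Y, hY0, hY, hL⟩ :=
    exists_column_limit (lam := lam) (c := c) (φ := φ) hε hlam hz
  have hneg := tendsto_primitive_neg hε hlam hz hL
  have heq := integralFromNegInfty_eq hz hneg
  refine ⟨fun x => ⟨primitive ε lam c z φ x - L 0, ?_⟩, fun w hw => ?_,
    fun k => L k - L 0, C, Y, sub_self _, hY0, hY, fun k w hw hi => ?_⟩
  · simp only [integral_neg_eq_primitive_sub hz]
    exact hneg.const_sub _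
  · have : integralFromNegInfty ε lam c z φ = fun w => primitive ε lam c z φ w - L 0 := funext heq
    rw [this]
    exact (hasDerivAt_primitive hz hw).sub_const _
  · rw [heq, sub_sub_sub_cancel_right]
    exact hL k w hw hi

end BenjaminOno

end

/-! ### Continuation of a primitive across an upper cut. -/

noncomputable section

namespace BenjaminOno

variable {P : ℕ} {ε lam : ℝ} {c z φ s : Fin P → ℂ}

theorem tendsto_ray_of_exp_decay {X : ℂ → ℂ} {L : ℂ} {C Y κ x : ℝ} (hκ : 0 < κ)
    (h : ∀ y : ℝ, Y < y → ‖X (x + y * I) - L‖ ≤ C * Real.exp (-κ * y)) :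
    Tendsto (fun y : ℝ => X (x + y * I)) atTop (𝓝 L) := by
  rw [tendsto_iff_norm_sub_tendsto_zero]
  exact squeeze_zero' (Eventually.of_forall fun _ => norm_nonneg _)
    ((eventually_gt_atTop Y).mono h) (tendsto_exp_neg_mul hκ C)

/-- Two primitives of the same function on a vertical ray differ by the difference of their limits
at `i∞`. -/
theorem sub_eq_sub_of_ray {X₁ X₂ g : ℂ → ℂ} {w L₁ L₂ : ℂ}
    (h₁ : ∀ y : ℝ, w.im ≤ y → HasDerivAt X₁ (g (w.re + y * I)) (w.re + y * I))
    (h₂ : ∀ y : ℝ, w.im ≤ y → HasDerivAt X₂ (g (w.re + y * I)) (w.re + y * I))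
    (t₁ : Tendsto (fun y : ℝ => X₁ (w.re + y * I)) atTop (𝓝 L₁))
    (t₂ : Tendsto (fun y : ℝ => X₂ (w.re + y * I)) atTop (𝓝 L₂)) :
    X₁ w - L₁ = X₂ w - L₂ := by
  have hd : ∀ y ∈ Set.Ici w.im, HasDerivWithinAt
      (fun y : ℝ => X₁ (w.re + y * I) - X₂ (w.re + y * I)) 0 (Set.Ici w.im) y := by
    intro y hy
    have e3 := (hasDerivAt_comp_vertical (h₁ y hy)).sub (hasDerivAt_comp_vertical (h₂ y hy))
    rw [sub_self] at e3
    exact e3.hasDerivWithinAt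
  have hconst : ∀ y : ℝ, w.im ≤ y →
      X₁ (w.re + y * I) - X₂ (w.re + y * I) = X₁ w - X₂ w := by
    intro y hy
    have := (convex_Ici w.im).norm_image_sub_le_of_norm_hasDerivWithin_le hd (C := 0)
      (by simp) (Set.self_mem_Ici) hy
    rw [zero_mul, norm_le_zero_iff, sub_eq_zero] at this
    simpa [re_add_im] using this
  have hlim : Tendsto (fun y : ℝ => X₁ (w.re + y * I) - X₂ (w.re + y * I)) atTop
      (𝓝 (X₁ w - X₂ w)) :=
    tendsto_const_nhds.congr' ((eventually_ge_atTop w.im).mono fun y hy => (hconst y hy).symm)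
  have := tendsto_nhds_unique hlim (t₁.sub t₂)
  linear_combination this

theorem log_I_mul_of_re_neg {u : ℂ} (hu : u.re < 0) :
    log (I * u) = log (-I * u) - Real.pi * I := by
  have h : I * u = -(-I * u) := by ring
  rw [h, log, log, arg_neg_eq_arg_sub_pi_of_im_pos (by simpa using hu), norm_neg]
  push_cast
  ring

theorem log_I_mul_of_re_pos {u : ℂ} (hu : 0 < u.re) :
    log (I * u) = log (-I * u) + Real.pi * I := by
  have h : I * u = -(-I * u) := by ring
  rw [h, log, log, arg_neg_eq_arg_add_pi_of_im_neg (by simpa using hu), norm_neg]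
  push_cast
  ring

/-- The choice of branches with the `m`-th cut going down from `z m`, the other ones going up. -/
def flipCut (m : Fin P) : Fin P → ℂ := Function.update (fun _ => I) m (-I)

theorem norm_flipCut (m p : Fin P) : ‖flipCut m p‖ = 1 := by
  unfold flipCut
  rcases eq_or_ne p m with rfl | h
  · simp
  · simp [Function.update_of_ne h]

theorem branch_sub_branch_flipCut (m : Fin P) (w : ℂ) :
    branch lam c z (fun _ => I) w - branch lam c z (flipCut m) w =
      c m * (log (I * (w - z m)) - log (-I * (w - z m))) := by
  unfold branch
  rw [add_sub_add_left_eq_sub, ← Finset.sum_sub_distrib,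
    Finset.sum_eq_single m (fun p _ hp => ?_) (fun h => absurd (Finset.mem_univ m) h)]
  · simp only [flipCut, Function.update_self]
    ring
  · simp [flipCut, Function.update_of_ne hp]

/-- Turning the `m`-th cut changes its logarithm by `-π i` on the left and by `π i` on the right
(`expFactor_right`). The two factors combine to the multiplier `exp (2 π c_m / ε)` across the cut.
-/
theorem expFactor_left (m : Fin P) {w : ℂ} (hw : w.re < (z m).re) :
    expFactor ε lam c z (fun _ => I) w =
      expFactor ε lam c z (flipCut m) w / exp (Real.pi * c m / ε) := by
  have h := branch_sub_branch_flipCut (lam := lam) (c := c) (z := z) m w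
  rw [log_I_mul_of_re_neg (u := w - z m) (by simpa using hw)] at h
  have h' : branch lam c z (fun _ => I) w =
    branch lam c z (flipCut m) w - c m * (Real.pi * I) := by linear_combination h
  rw [expFactor, expFactor, ← exp_sub, h']
  congr 1
  ring_nf
  rw [I_sq]
  ring

theorem expFactor_right (m : Fin P) {w : ℂ} (hw : (z m).re < w.re) :
    expFactor ε lam c z (fun _ => I) w =
      expFactor ε lam c z (flipCut m) w * exp (Real.pi * c m / ε) := by
  have h := branch_sub_branch_flipCut (lam := lam) (c := c) (z := z) m w
  rw [log_I_mul_of_re_pos (u := w - z m) (by simpa using hw)] at h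
  have h' : branch lam c z (fun _ => I) w =
    branch lam c z (flipCut m) w + c m * (Real.pi * I) := by linear_combination h
  rw [expFactor, expFactor, ← exp_add, h']
  congr 1
  ring_nf
  rw [I_sq]
  ring

/-- The half-strip above `z m`. -/
def upperStrip (z : Fin P → ℂ) (m : Fin P) (r : ℝ) : Set ℂ :=
  {w | |w.re - (z m).re| < r ∧ (z m).im < w.im}

theorem isOpen_upperStrip (m : Fin P) (r : ℝ) : IsOpen (upperStrip z m r) :=
  (isOpen_lt (f := fun w : ℂ => |w.re - (z m).re|) (by fun_prop) continuous_const).inter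
    (isOpen_lt continuous_const continuous_im)

theorem upperStrip_subset_branchDomain (hz : ∀ p, 0 < (z p).im) {m : Fin P} {r : ℝ}
    (hr : IsIsolatingRadius z m r) : upperStrip z m r ⊆ branchDomain z (flipCut m) := by
  rintro w ⟨h1, h2⟩ p
  have hw : 0 < w.im := (hz m).trans h2
  refine ⟨?_, ?_⟩
  · rw [mem_slitPlane_iff]
    rcases eq_or_ne p m with rfl | h
    · left
      simpa [flipCut] using h2
    · right
      have h3 := hr.lt_re p h
      simp only [flipCut, Function.update_of_ne h, mul_im, I_re, zero_mul, I_im, one_mul, zero_add,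
        sub_re]
      intro h0
      have : (z p).re - (z m).re = w.re - (z m).re := by linarith
      rw [this] at h3
      linarith [hr.pos]
  · rw [mem_slitPlane_iff]
    left
    simp
    linarith [hz p]

theorem vertical_mem_column {k : ℕ} {w : ℂ} (hw : w ∈ column z k) (y : ℝ) :
    (w.re + y * I : ℂ) ∈ column z k := by
  have h : (w.re + y * I : ℂ).re = w.re := by simp
  exact fun p => by rw [h]; exact hw p

theorem IsIsolatingRadius.mem_column_left (hre : StrictMono fun p => (z p).re) {m : Fin P} {r : ℝ}
    (hr : IsIsolatingRadius z m r) {w : ℂ} (h1 : |w.re - (z m).re| < r) (h2 : w.re < (z m).re) :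
    w ∈ column z m.val := by
  intro p
  rw [abs_lt] at h1
  refine ⟨fun h => ?_, fun h => ?_⟩
  · have hp : (z p).re < (z m).re := hre (Fin.lt_def.2 h)
    have h3 := hr.lt_re p (Fin.lt_def.2 h).ne
    rw [abs_of_neg (by linarith)] at h3
    linarith [hr.pos]
  · have hp : (z m).re ≤ (z p).re := hre.monotone (Fin.le_def.2 h)
    linarith

theorem IsIsolatingRadius.mem_column_right (hre : StrictMono fun p => (z p).re) {m : Fin P} {r : ℝ}
    (hr : IsIsolatingRadius z m r) {w : ℂ} (h1 : |w.re - (z m).re| < r) (h2 : (z m).re < w.re) :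
    w ∈ column z (m.val + 1) := by
  intro p
  rw [abs_lt] at h1
  refine ⟨fun h => ?_, fun h => ?_⟩
  · have hp : (z p).re ≤ (z m).re := hre.monotone (Fin.le_def.2 (by omega))
    linarith
  · have hpm : m < p := Fin.lt_def.2 (by omega)
    have hp : (z m).re < (z p).re := hre hpm
    have h3 := hr.lt_re p hpm.ne'
    rw [abs_of_pos (by linarith)] at h3
    linarith [hr.pos]

/-- Across the cut above `z m`, a primitive of the integrand continues from the left to the right up
to the factor `exp (2 π c m / ε)` and the limits at `i∞`. -/
theorem exists_continuation (hε : 0 < ε) (hlam : lam < 0) (hz : ∀ p, 0 < (z p).im)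
    (hre : StrictMono fun p => (z p).re) {m : Fin P} {r : ℝ} (hr : IsIsolatingRadius z m r)
    {F : ℂ → ℂ} (hF : ∀ w ∈ domainG z, HasDerivAt F (integrand ε lam c z φ w) w)
    {L : ℕ → ℂ} {C Y : ℝ} (hL : ∀ k, ∀ w ∈ column z k, Y < w.im →
      ‖F w - L k‖ ≤ C * Real.exp (-(-lam / ε) * w.im)) :
    ∃ Q : ℂ → ℂ, (∀ w ∈ upperStrip z m r, DifferentiableAt ℂ Q w) ∧
      ∀ w ∈ upperStrip z m r,
        (w.re < (z m).re → F w = Q w / exp (Real.pi * c m / ε) + L m.val) ∧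
        ((z m).re < w.re → F w = Q w * exp (Real.pi * c m / ε) + L (m.val + 1)) := by
  set ρ := exp (Real.pi * c m / ε) with hρ
  have hκ : 0 < -lam / ε := div_pos (neg_pos.2 hlam) hε
  set U := upperStrip z m r with hU
  set g₀ : ℂ → ℂ := fun w => expFactor ε lam c z (flipCut m) w * poleSum z φ w with hg₀
  have hgd : DifferentiableOn ℂ g₀ U :=
    differentiableOn_expFactor_mul_poleSum.mono (upperStrip_subset_branchDomain hz hr)
  set b : ℂ := z m + I with hb
  set Q₀ : ℂ → ℂ := fun w => wedgeIntegral b w g₀ with hQ₀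
  have hQd : ∀ w ∈ U, HasDerivAt Q₀ (g₀ w) w := by
    intro w hw
    refine hasDerivAt_wedgeIntegral_of_wedge_subset (isOpen_upperStrip m r) ?_ ?_ hgd hw
    · rintro x ⟨hx, -⟩ s hs
      have h1 := Set.abs_sub_left_of_mem_uIcc hs
      simp only [hb, add_re, I_re, add_zero] at h1
      refine ⟨?_, by simp [hb]⟩
      simpa using h1.trans_lt hx
    · rintro x ⟨hx, hx'⟩ t ht
      refine ⟨by simpa using hx, ?_⟩
      have h1 : min b.im x.im ≤ t := ht.1
      have h2 : (z m).im < min b.im x.im := lt_min (by simp [hb]) hx'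
      simpa using h2.trans_le h1
  obtain ⟨M, Y', -, -, hY', hbd⟩ :=
    exists_norm_expFactor_mul_poleSum_le (lam := lam) (c := c) (φ := φ) hε hz
  -- With the cut turned down, the strip above `z m` is undivided and there is a single limit at
  -- `i∞`.
  obtain ⟨LQ, hLQ⟩ := exists_limit_of_deriv_exp_decay (X := Q₀) (g := g₀)
    (J := {x | |x - (z m).re| < r})
    (by
      have : {x | |x - (z m).re| < r} = Metric.ball (z m).re r := by
        ext x; simp [Real.dist_eq]
      rw [this, Real.ball_eq_Ioo]
      exact Set.ordConnected_Ioo) (Y₀ := Y') (M := M) hκ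
    (fun w h1 h2 => hQd w ⟨h1, by linarith [hY' m]⟩)
    (fun w _ h2 => hbd _ (norm_flipCut m) w h2)
  have hup : ∀ w ∈ U, ∀ y : ℝ, w.im ≤ y → (w.re + y * I : ℂ) ∈ U := fun w hw y hy =>
    ⟨by simpa using hw.1, by simpa using hw.2.trans_le hy⟩
  have hQt : ∀ w ∈ U, Tendsto (fun y : ℝ => Q₀ (w.re + y * I)) atTop (𝓝 LQ) := fun w hw =>
    tendsto_ray_of_exp_decay hκ (Y := Y') fun y hy => by
      simpa using hLQ (w.re + y * I) (by simpa using hw.1) (by simpa using hy)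
  have hFt : ∀ k w, w ∈ column z k → Tendsto (fun y : ℝ => F (w.re + y * I)) atTop (𝓝 (L k)) :=
    fun k w hw => tendsto_ray_of_exp_decay hκ (Y := Y) fun y hy => by
      simpa using hL k (w.re + y * I) (vertical_mem_column hw y) (by simpa using hy)
  -- Once `Q` vanishes at `i∞`, the column limits of `F` are the only additive constants left; they
  -- are found by comparing primitives on upward rays.
  refine ⟨fun w => Q₀ w - LQ, fun w hw => (hQd w hw).differentiableAt.sub_const _,
    fun w hw => ⟨fun hlt => ?_, fun hlt => ?_⟩⟩
  · have hcol := hr.mem_column_left hre hw.1 hlt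
    have h1 := sub_eq_sub_of_ray (X₁ := F) (X₂ := fun w => Q₀ w / ρ)
      (g := integrand ε lam c z φ) (w := w)
      (fun y _ => hF _ (column_subset_domainG _ (vertical_mem_column hcol y)))
      (fun y hy => ?_) (hFt _ w hcol) ((hQt w hw).div_const ρ)
    · linear_combination h1
    · refine ((hQd _ (hup w hw y hy)).div_const ρ).congr_deriv ?_
      rw [integrand_eq, expFactor_left m (by simpa using hlt)]
      simp only [hg₀]
      ring
  · have hcol := hr.mem_column_right hre hw.1 hlt
    have h1 := sub_eq_sub_of_ray (X₁ := F) (X₂ := fun w => Q₀ w * ρ)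
      (g := integrand ε lam c z φ) (w := w)
      (fun y _ => hF _ (column_subset_domainG _ (vertical_mem_column hcol y)))
      (fun y hy => ?_) (hFt _ w hcol) ((hQt w hw).mul_const ρ)
    · linear_combination h1
    · refine ((hQd _ (hup w hw y hy)).mul_const ρ).congr_deriv ?_
      rw [integrand_eq, expFactor_right m (by simpa using hlt)]
      simp only [hg₀]
      ring

end BenjaminOno

end

/-! ### Behaviour near a branch point, in logarithmic coordinates. -/

noncomputable section

namespace BenjaminOno

variable {P : ℕ} {ε lam : ℝ} {c z φ s : Fin P → ℂ}

/-- Logarithmic coordinates at `z m`: the punctured slit disc is the image of a half-strip. -/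
def logChart (z : Fin P → ℂ) (m : Fin P) (ξ : ℂ) : ℂ := z m - I * exp (I * ξ)

theorem norm_logChart_sub (m : Fin P) (ξ : ℂ) : ‖logChart z m ξ - z m‖ = Real.exp (-ξ.im) := by
  simp [logChart, norm_exp]

theorem IsIsolatingRadius.im_pos {m : Fin P} {r : ℝ} (hr : IsIsolatingRadius z m r) {w : ℂ}
    (hw : ‖w - z m‖ ≤ r) : 0 < w.im := by
  have h1 := (abs_le.1 ((abs_im_le_norm (w - z m)).trans hw)).1
  have h2 := hr.lt_im
  rw [sub_im] at h1
  linarith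

/-- Here `I * (w - z m) = exp (I * ξ)`, so `Re ξ` is its argument and `‖w - z m‖ = exp (-Im ξ)`. The
two sides of the cut sit at `Re ξ = ± π`, and going up in `ξ` means approaching `z m`. -/
theorem logChart_mem_domainG (hz : ∀ p, 0 < (z p).im) {m : Fin P} {r : ℝ}
    (hr : IsIsolatingRadius z m r) {ξ : ℂ} (h1 : ξ.re ∈ Set.Ioo (-Real.pi) Real.pi)
    (h2 : -Real.log r < ξ.im) : logChart z m ξ ∈ domainG z := by
  have hn : ‖logChart z m ξ - z m‖ ≤ r := by
    rw [norm_logChart_sub, ← Real.le_log_iff_exp_le hr.pos]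
    linarith
  have him := hr.im_pos hn
  intro p
  refine ⟨?_, ?_⟩
  · by_cases hp : p = m
    · subst hp
      have e : I * (logChart z p ξ - z p) = exp (I * ξ) := by
        rw [logChart]
        ring_nf
        rw [I_sq]
        ring
      rw [e, mem_slitPlane_iff_arg]
      refine ⟨?_, exp_ne_zero _⟩
      have hl : log (exp (I * ξ)) = I * ξ := log_exp (by simpa using h1.1) (by simpa using h1.2.le)
      have ha : arg (exp (I * ξ)) = ξ.re := by rw [← log_im, hl]; simp
      rw [ha]
      exact h1.2.ne
    · rw [mem_slitPlane_iff]
      right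
      have h3 := hr.lt_re p hp
      have h4 := (abs_re_le_norm (logChart z m ξ - z m)).trans hn
      intro h0
      have h5 : (logChart z m ξ).re = (z p).re := by
        simp only [mul_im, I_re, zero_mul, I_im, one_mul, zero_add, sub_re] at h0
        linarith
      rw [sub_re, h5] at h4
      linarith [hr.pos]
  · rw [mem_slitPlane_iff]
    left
    simp only [mul_re, neg_re, I_re, neg_im, I_im, sub_im, conj_im, sub_re, conj_re]
    linarith [hz p]

theorem exists_logChart_eq {m : Fin P} {w : ℂ} (hw : w ∈ domainG z) :
    ∃ ξ : ℂ, logChart z m ξ = w ∧ ξ.re ∈ Set.Ioo (-Real.pi) Real.pi ∧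
      ξ.im = -Real.log ‖w - z m‖ := by
  have h1 := (hw m).1
  have h0 : I * (w - z m) ≠ 0 := slitPlane_ne_zero h1
  refine ⟨-I * log (I * (w - z m)), ?_, ?_, ?_⟩
  · have e : I * (-I * log (I * (w - z m))) = log (I * (w - z m)) := by
      ring_nf
      rw [I_sq]
      ring
    rw [logChart, e, exp_log h0]
    ring_nf
    rw [I_sq]
    ring
  · have : (-I * log (I * (w - z m))).re = arg (I * (w - z m)) := by simp [log_im]
    rw [this]
    exact ⟨neg_pi_lt_arg _, (arg_le_pi _).lt_of_ne (mem_slitPlane_iff_arg.1 h1).1⟩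
  · simp [log_re]

theorem hasDerivAt_comp_logChart {m : Fin P} {F : ℂ → ℂ}
    (hF : ∀ w ∈ domainG z, HasDerivAt F (integrand ε lam c z φ w) w) {ξ : ℂ}
    (hξ : logChart z m ξ ∈ domainG z) :
    HasDerivAt (fun ξ => F (logChart z m ξ))
      (integrand ε lam c z φ (logChart z m ξ) * exp (I * ξ)) ξ := by
  have h1 : HasDerivAt (logChart z m) (exp (I * ξ)) ξ := by
    have := (((hasDerivAt_id ξ).const_mul I).cexp.const_mul I).const_sub (z m)
    refine this.congr_deriv ?_
    simp only [id]
    ring_nf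
    rw [I_sq]
    ring
  exact HasDerivAt.comp ξ (hF _ hξ) h1

/-- The derivative of the chart supplies one more power of `‖w - z m‖`, turning the order `α - 1`
into decay at rate `α = Im c_m / ε`. For `α > 0` the lemma about limits at `i∞` then gives the limit
at `z m`. -/
theorem exists_norm_integrand_logChart (hε : 0 < ε) (hz : ∀ p, 0 < (z p).im) {m : Fin P} {r : ℝ}
    (hr : IsIsolatingRadius z m r) :
    ∃ C : ℝ, 0 < C ∧ ∀ ξ : ℂ, -Real.log r < ξ.im →
      ‖integrand ε lam c z φ (logChart z m ξ) * exp (I * ξ)‖ ≤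
        C * Real.exp (-((c m).im / ε) * ξ.im) := by
  obtain ⟨C, hC, h⟩ := exists_norm_integrand_near (lam := lam) (c := c) (φ := φ) hε hz hr
  refine ⟨C, hC, fun ξ hξ => ?_⟩
  have hn : ‖logChart z m ξ - z m‖ ≤ r := by
    rw [norm_logChart_sub, ← Real.le_log_iff_exp_le hr.pos]
    linarith
  have hne : logChart z m ξ ≠ z m := by
    rw [← sub_ne_zero, ← norm_pos_iff, norm_logChart_sub]
    exact Real.exp_pos _
  have h1 := h _ hne hn
  rw [norm_logChart_sub, ← Real.exp_mul] at h1
  rw [norm_mul, norm_exp]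
  have e : (I * ξ).re = -ξ.im := by simp
  rw [e]
  calc _ ≤ C * Real.exp (-ξ.im * ((c m).im / ε - 1)) * Real.exp (-ξ.im) := by gcongr
    _ = _ := by
      rw [mul_assoc, ← Real.exp_add]
      congr 2
      ring

/-- If `Im (c m) > 0`, a primitive of the integrand has a limit at `z m`. -/
theorem exists_limit_at_branchPoint (hε : 0 < ε) (hz : ∀ p, 0 < (z p).im) {m : Fin P} {r : ℝ}
    (hr : IsIsolatingRadius z m r) (hα : 0 < (c m).im / ε) {F : ℂ → ℂ}
    (hF : ∀ w ∈ domainG z, HasDerivAt F (integrand ε lam c z φ w) w) :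
    ∃ (Fm : ℂ) (C : ℝ), ∀ w ∈ domainG z, ‖w - z m‖ < r →
      ‖F w - Fm‖ ≤ C * ‖w - z m‖ ^ ((c m).im / ε) := by
  obtain ⟨C, hC, h⟩ := exists_norm_integrand_logChart (lam := lam) (c := c) (φ := φ) hε hz hr
  obtain ⟨Fm, hFm⟩ := exists_limit_of_deriv_exp_decay (X := fun ξ => F (logChart z m ξ))
    (J := Set.Ioo (-Real.pi) Real.pi) Set.ordConnected_Ioo (Y₀ := -Real.log r) (M := C) hα
    (fun ξ h1 h2 => hasDerivAt_comp_logChart hF (logChart_mem_domainG hz hr h1 h2))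
    (fun ξ h1 h2 => h ξ h2)
  refine ⟨Fm, C / ((c m).im / ε), fun w hw hwr => ?_⟩
  obtain ⟨ξ, rfl, h1, h2⟩ := exists_logChart_eq (m := m) hw
  have hpos : 0 < ‖logChart z m ξ - z m‖ := by
    rw [norm_logChart_sub]; exact Real.exp_pos _
  have h3 := hFm ξ h1 (by
    rw [h2]
    exact neg_lt_neg (Real.log_lt_log hpos hwr))
  refine h3.trans (le_of_eq ?_)
  rw [norm_logChart_sub, ← Real.exp_mul]
  congr 2
  ring

/-- If `Im (c m) ≤ 0`, radial growth of a primitive of the integrand near `z m`. -/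
theorem exists_radial_estimate (hε : 0 < ε) (hz : ∀ p, 0 < (z p).im) {m : Fin P} {r : ℝ}
    (hr : IsIsolatingRadius z m r) (hα : (c m).im / ε ≤ 0) {F : ℂ → ℂ}
    (hF : ∀ w ∈ domainG z, HasDerivAt F (integrand ε lam c z φ w) w) {r' : ℝ} (hr' : 0 < r')
    (hrr : r' < r) :
    ∃ C : ℝ, 0 < C ∧ ∀ w ∈ domainG z, ‖w - z m‖ ≤ r' → ∃ v ∈ domainG z, ‖v - z m‖ = r' ∧
      ‖F w - F v‖ ≤ C * (Real.log r' - Real.log ‖w - z m‖) * ‖w - z m‖ ^ ((c m).im / ε) := by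
  obtain ⟨C, hC, h⟩ := exists_norm_integrand_logChart (lam := lam) (c := c) (φ := φ) hε hz hr
  refine ⟨C, hC, fun w hw hwr => ?_⟩
  obtain ⟨ξ, rfl, h1, h2⟩ := exists_logChart_eq (m := m) hw
  have hpos : 0 < ‖logChart z m ξ - z m‖ := by
    rw [norm_logChart_sub]; exact Real.exp_pos _
  have hlr : Real.log r' < Real.log r := Real.log_lt_log hr' hrr
  have hle : -Real.log r' ≤ ξ.im := by
    rw [h2]
    exact neg_le_neg (Real.log_le_log hpos hwr)
  have hG : ∀ t : ℝ, -Real.log r' ≤ t → logChart z m (ξ.re + t * I) ∈ domainG z := fun t ht =>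
    logChart_mem_domainG hz hr (by simpa using h1) (by simp; linarith)
  refine ⟨logChart z m (ξ.re + (-Real.log r' : ℝ) * I), hG _ le_rfl, ?_, ?_⟩
  · rw [norm_logChart_sub]
    simp [Real.exp_log hr']
  obtain ⟨X, hX⟩ : ∃ X : ℝ → ℂ, X = fun t : ℝ => F (logChart z m (ξ.re + t * I)) := ⟨_, rfl⟩
  obtain ⟨X', hX'⟩ : ∃ X' : ℝ → ℂ, X' = fun t : ℝ =>
    integrand ε lam c z φ (logChart z m (ξ.re + t * I)) * exp (I * (ξ.re + t * I)) * I := ⟨_, rfl⟩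
  have hd : ∀ t ∈ Set.Icc (-Real.log r') ξ.im,
      HasDerivWithinAt X (X' t) (Set.Icc (-Real.log r') ξ.im) t := by
    intro t ht
    have hd' := hasDerivAt_comp_vertical (hasDerivAt_comp_logChart hF (hG t ht.1))
    rw [hX, hX']
    exact hd'.hasDerivWithinAt
  -- For `α ≤ 0` the bound is largest at the end nearest `z m`. The mean value inequality multiplies
  -- it by the length of the segment, which is the logarithmic factor.
  have hX'b : ∀ t ∈ Set.Icc (-Real.log r') ξ.im,
      ‖X' t‖ ≤ C * Real.exp (-((c m).im / ε) * ξ.im) := by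
    intro t ht
    simp only [hX']
    rw [norm_mul, norm_I, mul_one]
    have h3 := h (ξ.re + t * I) (by simp; linarith [ht.1])
    have e : (ξ.re + t * I : ℂ).im = t := by simp
    rw [e] at h3
    refine h3.trans (mul_le_mul_of_nonneg_left (Real.exp_le_exp.2 ?_) hC.le)
    exact mul_le_mul_of_nonneg_left ht.2 (by linarith)
  have hmvt := (convex_Icc (-Real.log r') ξ.im).norm_image_sub_le_of_norm_hasDerivWithin_le hd
    hX'b (Set.left_mem_Icc.2 hle) (Set.right_mem_Icc.2 hle)
  have e1 : X ξ.im = F (logChart z m ξ) := by rw [hX]; simp only [re_add_im]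
  have e2 : X (-Real.log r') = F (logChart z m (ξ.re + (-Real.log r' : ℝ) * I)) := by rw [hX]
  rw [← e1, ← e2]
  refine hmvt.trans (le_of_eq ?_)
  rw [Real.norm_of_nonneg (by linarith), norm_logChart_sub, Real.log_exp, ← Real.exp_mul]
  have e : -((c m).im / ε) * ξ.im = -ξ.im * ((c m).im / ε) := by ring
  rw [e]
  ring

/-- Removal of an isolated singularity at which the function grows at most logarithmically along
the trace of a set `G` accumulating at each point from the right. -/
theorem exists_analyticAt_of_log_growth {G : Set ℂ} (hG : ∀ w : ℂ, ∀ᶠ t : ℝ in 𝓝[>] 0, w + t ∈ G)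
    {Ψ : ℂ → ℂ} {a : ℂ} {r A B : ℝ} (hr : 0 < r)
    (hΨ : ∀ w, w ≠ a → ‖w - a‖ < r → DifferentiableAt ℂ Ψ w)
    (hb : ∀ w ∈ G, w ≠ a → ‖w - a‖ < r → ‖Ψ w‖ ≤ A - B * Real.log ‖w - a‖) :
    ∃ Θ : ℂ → ℂ, AnalyticAt ℂ Θ a ∧ ∀ w, w ≠ a → Θ w = Ψ w := by
  have hb' : ∀ w, w ≠ a → ‖w - a‖ < r → ‖Ψ w‖ ≤ A - B * Real.log ‖w - a‖ := by
    intro w hw hwr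
    have hc : Tendsto (fun t : ℝ => w + t) (𝓝[>] 0) (𝓝 w) := by
      have : ContinuousAt (fun t : ℝ => w + t) 0 := by fun_prop
      simpa [ContinuousAt] using this.tendsto.mono_left nhdsWithin_le_nhds
    have h1 := ((hΨ w hw hwr).continuousAt.norm.tendsto).comp hc
    have h2 : ContinuousAt (fun w : ℂ => A - B * Real.log ‖w - a‖) w := by
      have : ContinuousAt (fun w : ℂ => Real.log ‖w - a‖) w :=
        ContinuousAt.log (by fun_prop) (norm_ne_zero_iff.2 (sub_ne_zero.2 hw))
      fun_prop
    refine le_of_tendsto_of_tendsto h1 (h2.tendsto.comp hc) ?_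
    have h3 : ∀ᶠ v in 𝓝 w, v ≠ a ∧ ‖v - a‖ < r := by
      refine (eventually_ne_nhds hw).and ?_
      exact (continuous_id.sub continuous_const).norm.continuousAt.eventually_lt_const hwr
    filter_upwards [hG w, hc.eventually h3] with t ht ht' using hb _ ht ht'.1 ht'.2
  refine ⟨Function.update Ψ a (limUnder (𝓝[≠] a) Ψ), ?_, fun w hw => by simp [hw]⟩
  have hs : Metric.ball a r ∈ 𝓝 a := Metric.ball_mem_nhds a hr
  refine (differentiableOn_update_limUnder_of_isLittleO hs (fun w hw => ?_) ?_).analyticAt hs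
  · exact (hΨ w hw.2 (by simpa [dist_eq] using hw.1)).differentiableWithinAt
  · rw [Asymptotics.isLittleO_iff_tendsto']
    -- Removability needs `Ψ w - Ψ a = o(1 / ‖w - a‖)`, which follows from `u log u → 0`. The term
    -- `‖Ψ a‖` accounts for the arbitrary value at `a`.
    · have hlim : Tendsto (fun w : ℂ => (A + ‖Ψ a‖) * ‖w - a‖ -
          B * (‖w - a‖ * Real.log ‖w - a‖)) (𝓝[≠] a) (𝓝 0) := by
        have hc : Continuous (fun w : ℂ => (A + ‖Ψ a‖) * ‖w - a‖ -
            B * (‖w - a‖ * Real.log ‖w - a‖)) := by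
          have := Real.continuous_mul_log.comp (continuous_id.sub (continuous_const (y := a))).norm
          have h2 : Continuous fun w : ℂ => ‖w - a‖ * Real.log ‖w - a‖ := this
          fun_prop
        have := (hc.tendsto a).mono_left (nhdsWithin_le_nhds (s := {a}ᶜ))
        simpa using this
      refine squeeze_zero_norm' ?_ hlim
      have hnear : ∀ᶠ w in 𝓝[≠] a, ‖w - a‖ < r := by
        filter_upwards [nhdsWithin_le_nhds hs] with w hw
        simpa [dist_eq] using hw
      filter_upwards [self_mem_nhdsWithin, hnear] with w hw hwr
      rw [div_inv_eq_mul, norm_mul]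
      have h1 := hb' w hw hwr
      have h2 := norm_sub_le (Ψ w) (Ψ a)
      calc _ ≤ (A - B * Real.log ‖w - a‖ + ‖Ψ a‖) * ‖w - a‖ := by gcongr; linarith
        _ = _ := by ring
    · filter_upwards [self_mem_nhdsWithin] with w hw h0
      exact absurd (inv_eq_zero.1 h0) (sub_ne_zero.2 hw)

end BenjaminOno

end

/-! ### Contour integrals as differences of limits of a primitive. -/

noncomputable section

namespace BenjaminOno

variable {P : ℕ} {ε lam : ℝ} {c z φ : Fin P → ℂ} {F : ℂ → ℂ} {γ : ℝ → ℂ}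

theorem tendsto_comp_of_column {L : ℂ} {C Y κ : ℝ} (hκ : 0 < κ) {k : ℕ} {l : Filter ℝ}
    (hL : ∀ w ∈ column z k, Y < w.im → ‖F w - L‖ ≤ C * Real.exp (-κ * w.im))
    (him : Tendsto (fun t => (γ t).im) l atTop) (hcol : ∀ᶠ t in l, γ t ∈ column z k) :
    Tendsto (fun t => F (γ t)) l (𝓝 L) := by
  rw [tendsto_iff_norm_sub_tendsto_zero]
  refine squeeze_zero' (Eventually.of_forall fun _ => norm_nonneg _) ?_
    ((tendsto_exp_neg_mul hκ C).comp him)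
  filter_upwards [hcol, him.eventually_gt_atTop Y] with t ht hY
  exact hL _ ht hY

theorem StartsAtTop.eventually_mem (h : StartsAtTop z γ) : ∀ᶠ t in atBot, γ t ∈ column z 0 := by
  obtain ⟨-, K, T, hT⟩ := h
  exact (eventually_le_atBot T).mono fun t ht => (hT t ht).1

theorem EndsAtTop.eventually_mem {k : ℕ} (h : EndsAtTop z k γ) :
    ∀ᶠ t in atTop, γ t ∈ column z k := by
  obtain ⟨-, K, T, hT⟩ := h
  exact (eventually_ge_atTop T).mono fun t ht => (hT t ht).1

theorem StartsAtTop.exists_integrableOn (hε : 0 < ε) (hlam : lam < 0) (hz : ∀ p, 0 < (z p).im)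
    {J : Set ℝ} (hγ : PiecewiseC1On γ J) (h : StartsAtTop z γ) {T₀ : ℝ} (hJ : Set.Iic T₀ ⊆ J) :
    ∃ T < T₀, IntegrableOn (fun t => integrand ε lam c z φ (γ t) * deriv γ t) (Set.Iic T) := by
  obtain ⟨M, Y, hM, -, -, hbd⟩ :=
    exists_norm_expFactor_mul_poleSum_le (lam := lam) (c := c) (φ := φ) hε hz
  obtain ⟨him, K, T₁, hT₁⟩ := h
  obtain ⟨T₂, hT₂⟩ := eventually_atBot.1 (him.eventually_gt_atTop Y)
  have l0 : min (min T₁ T₂) (T₀ - 1) ≤ T₀ - 1 := min_le_right _ _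
  have l1 : min (min T₁ T₂) (T₀ - 1) ≤ T₁ := (min_le_left _ _).trans (min_le_left _ _)
  have l2 : min (min T₁ T₂) (T₀ - 1) ≤ T₂ := (min_le_left _ _).trans (min_le_right _ _)
  refine ⟨min (min T₁ T₂) (T₀ - 1), by linarith, ?_⟩
  refine hγ.integrableOn_Iic_of_tail (κ := -lam / ε) (K := K) (Y := Y) (G := domainG z)
    ((Set.Iic_subset_Iic.2 (by linarith)).trans hJ) differentiableOn_integrand.continuousOn
    (fun t ht => column_subset_domainG 0 (hT₁ t (ht.trans l1)).1) (div_pos (neg_pos.2 hlam) hε)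
    hM.le (fun t ht => ?_) (fun t ht => (hT₂ t (ht.trans l2)).le)
    (fun t ht => (hT₁ t (ht.trans l1)).2)
  exact hbd (fun _ => I) (by simp) _ (hT₂ t (ht.trans l2))

theorem EndsAtTop.exists_integrableOn (hε : 0 < ε) (hlam : lam < 0) (hz : ∀ p, 0 < (z p).im)
    {J : Set ℝ} {k : ℕ} (hγ : PiecewiseC1On γ J) (h : EndsAtTop z k γ) {T₀ : ℝ}
    (hJ : Set.Ici T₀ ⊆ J) :
    ∃ T > T₀, IntegrableOn (fun t => integrand ε lam c z φ (γ t) * deriv γ t) (Set.Ioi T) := by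
  obtain ⟨M, Y, hM, -, -, hbd⟩ :=
    exists_norm_expFactor_mul_poleSum_le (lam := lam) (c := c) (φ := φ) hε hz
  obtain ⟨him, K, T₁, hT₁⟩ := h
  obtain ⟨T₂, hT₂⟩ := eventually_atTop.1 (him.eventually_gt_atTop Y)
  have l0 : T₀ + 1 ≤ max (max T₁ T₂) (T₀ + 1) := le_max_right _ _
  have l1 : T₁ ≤ max (max T₁ T₂) (T₀ + 1) := (le_max_left _ _).trans (le_max_left _ _)
  have l2 : T₂ ≤ max (max T₁ T₂) (T₀ + 1) := (le_max_right _ _).trans (le_max_left _ _)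
  refine ⟨max (max T₁ T₂) (T₀ + 1), by linarith, ?_⟩
  refine hγ.integrableOn_Ioi_of_tail (κ := -lam / ε) (K := K) (Y := Y) (G := domainG z)
    ((Set.Ici_subset_Ici.2 (by linarith)).trans hJ) differentiableOn_integrand.continuousOn
    (fun t ht => column_subset_domainG k (hT₁ t (l1.trans ht)).1) (div_pos (neg_pos.2 hlam) hε)
    hM.le (fun t ht => ?_) (fun t ht => (hT₂ t (l2.trans ht)).le)
    (fun t ht => (hT₁ t (l1.trans ht)).2)
  exact hbd (fun _ => I) (by simp) _ (hT₂ t (l2.trans ht))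

/-- The integral over a contour from `i∞` to `i∞` converges absolutely and is the difference of the
limits of a primitive. -/
theorem IsContourU.integral_eq (hε : 0 < ε) (hlam : lam < 0) (hz : ∀ p, 0 < (z p).im) {k : ℕ}
    (h : IsContourU z k γ) (hF : ∀ w ∈ domainG z, HasDerivAt F (integrand ε lam c z φ w) w)
    {L : ℕ → ℂ} {C Y : ℝ} (hL : ∀ k, ∀ w ∈ column z k, Y < w.im →
      ‖F w - L k‖ ≤ C * Real.exp (-(-lam / ε) * w.im)) :
    Integrable (fun t => integrand ε lam c z φ (γ t) * deriv γ t) ∧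
      ∫ t, integrand ε lam c z φ (γ t) * deriv γ t = L k - L 0 := by
  obtain ⟨hγ, hG, hs, he⟩ := h
  have hκ : 0 < -lam / ε := div_pos (neg_pos.2 hlam) hε
  have hloc : ∀ a b : ℝ, a ≤ b →
      IntegrableOn (fun t => integrand ε lam c z φ (γ t) * deriv γ t) (Set.Icc a b) := fun a b hab =>
    hγ.integrableOn_comp_mul_deriv hab (Set.subset_univ _)
      differentiableOn_integrand.continuousOn fun t _ => hG t
  obtain ⟨T₁, h1, i1⟩ := hs.exists_integrableOn (c := c) (φ := φ) hε hlam hz hγ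
    (Set.subset_univ (Set.Iic 0))
  obtain ⟨T₂, h2, i2⟩ := he.exists_integrableOn (c := c) (φ := φ) hε hlam hz hγ
    (Set.subset_univ (Set.Ici 0))
  have hint : Integrable (fun t => integrand ε lam c z φ (γ t) * deriv γ t) := by
    rw [← integrableOn_univ]
    refine ((i1.union (hloc T₁ T₂ (by linarith))).union i2).mono_set fun t _ => ?_
    rcases le_or_gt t T₁ with h | h
    · exact Or.inl (Or.inl h)
    rcases le_or_gt t T₂ with h' | h'
    · exact Or.inl (Or.inr ⟨h.le, h'⟩)
    · exact Or.inr h'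
  refine ⟨hint, tendsto_nhds_unique
    (intervalIntegral_tendsto_integral hint tendsto_neg_atTop_atBot tendsto_id) ?_⟩
  have hlim := (tendsto_comp_of_column hκ (hL k) he.1 he.eventually_mem).sub
    ((tendsto_comp_of_column hκ (hL 0) hs.1 hs.eventually_mem).comp tendsto_neg_atTop_atBot)
  refine hlim.congr' ?_
  filter_upwards [eventually_ge_atTop 0] with T hT
  have hle : -T ≤ T := by linarith
  refine (hγ.integral_comp_mul_deriv hle (Set.subset_univ _) hF (fun t _ => hG t) ?_
    (hloc _ _ hle)).symm
  intro t _
  exact (ContinuousAt.comp_continuousWithinAt (hF _ (hG t)).continuousAt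
    (hγ.1.mono (Set.subset_univ _) t ‹_›))

/-- The integral over a contour from `i∞` to a branch point where the exponent of the integrand is
nonnegative converges absolutely, and it is the difference of the limits of a primitive. -/
theorem IsContourEll.integral_eq (hε : 0 < ε) (hlam : lam < 0) (hz : ∀ p, 0 < (z p).im)
    {m : Fin P} (h : IsContourEll z m γ)
    (hF : ∀ w ∈ domainG z, HasDerivAt F (integrand ε lam c z φ w) w)
    {L : ℕ → ℂ} {C Y : ℝ} (hL : ∀ k, ∀ w ∈ column z k, Y < w.im →
      ‖F w - L k‖ ≤ C * Real.exp (-(-lam / ε) * w.im))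
    {r : ℝ} (hr : IsIsolatingRadius z m r) (hα : 1 ≤ (c m).im / ε) {Fm : ℂ} {C' : ℝ}
    (hFm : ∀ w ∈ domainG z, ‖w - z m‖ < r → ‖F w - Fm‖ ≤ C' * ‖w - z m‖ ^ ((c m).im / ε)) :
    IntegrableOn (fun t => integrand ε lam c z φ (γ t) * deriv γ t) (Set.Iic 0) ∧
      ∫ t in Set.Iic 0, integrand ε lam c z φ (γ t) * deriv γ t = Fm - L 0 := by
  obtain ⟨hγ, hG, h0, hs⟩ := h
  have hκ : 0 < -lam / ε := div_pos (neg_pos.2 hlam) hε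
  have hgc : ContinuousOn (integrand ε lam c z φ) (domainG z) :=
    differentiableOn_integrand.continuousOn
  have hzm : z m ∉ domainG z := fun hm =>
    sub_ne_zero_of_mem_branchDomain (s := fun _ => I) hm m (sub_self _)
  obtain ⟨D, hD, hnear⟩ := exists_norm_integrand_near (lam := lam) (c := c) (φ := φ) hε hz hr
  have hball : ∀ᶠ t in 𝓝[Set.Iic 0] (0 : ℝ), ‖γ t - z m‖ < r := by
    have h1 : Tendsto (fun t => ‖γ t - z m‖) (𝓝[Set.Iic 0] 0) (𝓝 0) := by
      have := ((hγ.1 0 Set.self_mem_Iic).sub_const (z m)).norm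
      simpa [ContinuousWithinAt, h0] using this
    exact h1.eventually_lt_const hr.pos
  obtain ⟨b, hb0, hb⟩ : ∃ b < (0 : ℝ), ∀ t ∈ Set.Icc b 0, ‖γ t - z m‖ < r := by
    obtain ⟨δ, hδ, hsub⟩ := Metric.mem_nhdsWithin_iff.1 hball
    refine ⟨-(δ / 2), by linarith, fun t ht => hsub ⟨?_, ht.2⟩⟩
    rw [Metric.mem_ball, Real.dist_eq, sub_zero, abs_of_nonpos ht.2]
    linarith [ht.1]
  -- For `α ≥ 1` the order `α - 1` is nonnegative, so the integrand is bounded near `z m`, and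
  -- `deriv γ` is integrable.
  have hnearint : IntegrableOn (fun t => integrand ε lam c z φ (γ t) * deriv γ t)
      (Set.Icc b 0) := by
    rw [integrableOn_Icc_iff_integrableOn_Ioo]
    have hd : IntegrableOn (deriv γ) (Set.Ioo b 0) :=
      (hγ.integrableOn_deriv hb0.le (fun t ht => ht.2)).mono_set Set.Ioo_subset_Icc_self
    refine Integrable.bdd_mul (c := D * r ^ ((c m).im / ε - 1)) hd ?_ ?_
    · refine ContinuousOn.aestronglyMeasurable ?_ measurableSet_Ioo
      exact hgc.comp (hγ.1.mono fun t ht => ht.2.le) fun t ht => hG t ht.2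
    · filter_upwards [ae_restrict_mem measurableSet_Ioo] with t ht
      have h1 := hb t (Set.Ioo_subset_Icc_self ht)
      refine (hnear (γ t) (fun he => hzm (he ▸ hG t ht.2)) h1.le).trans ?_
      gcongr
  obtain ⟨T, hT, i1⟩ := hs.exists_integrableOn (c := c) (φ := φ) hε hlam hz hγ
    (Set.Iic_subset_Iic.2 hb0.le)
  have i2 : IntegrableOn (fun t => integrand ε lam c z φ (γ t) * deriv γ t) (Set.Icc T b) :=
    hγ.integrableOn_comp_mul_deriv hT.le (fun t ht => ht.2.trans hb0.le) hgc
      fun t ht => hG t (ht.2.trans_lt hb0)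
  have hint : IntegrableOn (fun t => integrand ε lam c z φ (γ t) * deriv γ t) (Set.Iic 0) := by
    refine ((i1.union i2).union hnearint).mono_set fun t ht => ?_
    rcases le_or_gt t T with h | h
    · exact Or.inl (Or.inl h)
    rcases le_or_gt t b with h' | h'
    · exact Or.inl (Or.inr ⟨h.le, h'⟩)
    · exact Or.inr ⟨h'.le, ht⟩
  refine ⟨hint, tendsto_nhds_unique
    (intervalIntegral_tendsto_integral_Iic 0 hint tendsto_id) ?_⟩
  refine ((tendsto_comp_of_column hκ (hL 0) hs.1 hs.eventually_mem).const_sub Fm).congr' ?_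
  filter_upwards [eventually_lt_atBot 0] with a ha
  -- Giving `F` the value `Fm` at `z m` makes it continuous along the curve up to the endpoint, as
  -- the fundamental theorem requires.
  have hX : ∀ w ∈ domainG z, HasDerivAt (Function.update F (z m) Fm) (integrand ε lam c z φ w) w := by
    intro w hw
    refine (hF w hw).congr_of_eventuallyEq ?_
    filter_upwards [isOpen_domainG.mem_nhds hw] with v hv
    exact Function.update_of_ne (ne_of_mem_of_not_mem hv hzm) _ _
  have hXeq : ∀ t < 0, Function.update F (z m) Fm (γ t) = F (γ t) := fun t ht =>
    Function.update_of_ne (ne_of_mem_of_not_mem (hG t ht) hzm) _ _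
  have hFTC := hγ.integral_comp_mul_deriv ha.le (fun t ht => ht.2) hX (fun t ht => hG t ht.2) ?_
    (hint.mono_set fun t ht => ht.2)
  · rw [id, hFTC, h0, Function.update_self, hXeq a ha]
  · intro t ht
    have hct : ContinuousWithinAt γ (Set.Icc a 0) t := hγ.1.mono (fun t ht => ht.2) t ht
    rcases ht.2.eq_or_lt with rfl | hlt
    · have hb' : ∀ᶠ s in 𝓝[Set.Icc a 0] (0 : ℝ), ‖Function.update F (z m) Fm (γ s) - Fm‖ ≤
          C' * ‖γ s - z m‖ ^ ((c m).im / ε) := by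
        filter_upwards [self_mem_nhdsWithin, nhdsWithin_mono 0 (fun t ht => ht.2) hball]
          with s hs hsr
        rcases hs.2.eq_or_lt with rfl | hs0
        · simp [h0, Real.zero_rpow (by linarith : (c m).im / ε ≠ 0)]
        · rw [hXeq s hs0]
          exact hFm _ (hG s hs0) hsr
      have hlim : Tendsto (fun s => C' * ‖γ s - z m‖ ^ ((c m).im / ε)) (𝓝[Set.Icc a 0] 0)
          (𝓝 0) := by
        have h1 := (((hct.sub_const (z m)).norm).rpow_const (p := (c m).im / ε)
          (Or.inr (by linarith))).const_mul C'
        simpa [ContinuousWithinAt, h0, Real.zero_rpow (by linarith : (c m).im / ε ≠ 0)] using h1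
      rw [ContinuousWithinAt, h0, Function.update_self, tendsto_iff_norm_sub_tendsto_zero]
      exact squeeze_zero' (Eventually.of_forall fun _ => norm_nonneg _) hb' hlim
    · exact ContinuousAt.comp_continuousWithinAt (hX _ (hG t hlt)).continuousAt hct

end BenjaminOno

end

/-! ### Relations between the limits on the two sides of a cut. -/

noncomputable section

namespace BenjaminOno

variable {P : ℕ} {ε lam : ℝ} {c z φ : Fin P → ℂ} {F : ℂ → ℂ}

theorem Phi_eq (w : ℂ) : Phi ε lam c z φ w = -(I / ε) *
    (integralFromNegInfty ε lam c z φ w / expFactor ε lam c z (fun _ => I) w) := by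
  have h1 : expFactor ε lam c z (fun _ => I) w = (exp (I * h lam c z w / ε))⁻¹ := by
    rw [← exp_neg]
    change exp (-I * h lam c z w / ε) = _
    congr 1
    ring
  rw [Phi, h1, div_inv_eq_mul]
  ring

theorem Exceptional.one_le {m : Fin P} (h : Exceptional ε c m) :
    1 ≤ (c m).im / ε := by
  obtain ⟨n, hn, h⟩ := h
  have h1 := congrArg re h
  rw [div_ofReal_re] at h1
  simp only [mul_re, I_re, zero_mul, I_im, one_mul, zero_sub, neg_re, natCast_re] at h1
  have : (c m).im / ε = n := by linear_combination -h1
  rw [this]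
  exact_mod_cast hn

/-- Trivial multiplier means that `i c_m / ε` is an integer; the condition `Im c_m > 0` picks out
the strictly negative ones. -/
theorem exceptional_iff (hε : 0 < ε) {m : Fin P} (hα : 0 < (c m).im / ε) :
    Exceptional ε c m ↔ exp (Real.pi * c m / ε) ^ 2 = 1 := by
  have hε' : (ε : ℂ) ≠ 0 := ofReal_ne_zero.2 hε.ne'
  have hπ : (Real.pi : ℂ) ≠ 0 := ofReal_ne_zero.2 Real.pi_ne_zero
  rw [← exp_nat_mul, exp_eq_one_iff]
  have key : ∀ n : ℤ, ((2 : ℕ) : ℂ) * (Real.pi * c m / ε) = n * (2 * Real.pi * I) ↔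
      I * c m / ε = -n := by
    intro n
    push_cast
    constructor
    · intro h
      have h2 : c m / ε = n * I := by
        refine mul_left_cancel₀ (mul_ne_zero two_ne_zero hπ) ?_
        linear_combination h
      rw [mul_div_assoc, h2]
      linear_combination (n : ℂ) * I_sq
    · intro h
      linear_combination (-2 * Real.pi * I : ℂ) * h + (2 * Real.pi * c m / ε : ℂ) * I_sq
  simp only [key]
  constructor
  · rintro ⟨n, -, h⟩
    exact ⟨n, by simpa using h⟩
  · rintro ⟨n, h⟩
    have h1 := congrArg re h
    rw [div_ofReal_re] at h1
    simp only [mul_re, I_re, zero_mul, I_im, one_mul, zero_sub, neg_re, intCast_re] at h1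
    have h2 : (0 : ℝ) < n := by
      have : (c m).im / ε = n := by linear_combination -h1
      rwa [← this]
    have h3 : 0 < n := by exact_mod_cast h2
    refine ⟨n.toNat, by omega, ?_⟩
    have h4 : ((n.toNat : ℕ) : ℂ) = (n : ℂ) := by
      rw [← Int.cast_natCast, Int.toNat_of_nonneg h3.le]
    rw [h4, h]

/-- Reaches points on a cut horizontally from within `G`: `σ = -1` approaches from the left, `σ = 1`
from the right. -/
theorem norm_le_of_eventually_norm_le {A : ℂ → ℂ} {B : ℂ → ℝ} {w : ℂ} (hA : ContinuousAt A w)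
    (hB : ContinuousAt B w) {σ : ℝ} (h : ∀ᶠ t : ℝ in 𝓝[>] 0, ‖A (w + σ * t)‖ ≤ B (w + σ * t)) :
    ‖A w‖ ≤ B w := by
  have hc : Tendsto (fun t : ℝ => w + σ * t) (𝓝[>] 0) (𝓝 w) := by
    have : ContinuousAt (fun t : ℝ => w + σ * t) 0 := by fun_prop
    simpa [ContinuousAt] using this.tendsto.mono_left nhdsWithin_le_nhds
  exact le_of_tendsto_of_tendsto (hA.norm.tendsto.comp hc) (hB.tendsto.comp hc) h

theorem eq_of_eventually_eq {A : ℂ → ℂ} {w a : ℂ} (hA : ContinuousAt A w) {σ : ℝ}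
    (h : ∀ᶠ t : ℝ in 𝓝[>] 0, A (w + σ * t) = a) : A w = a := by
  have := norm_le_of_eventually_norm_le (A := fun w => A w - a) (B := fun _ => 0) (σ := σ)
    (hA.sub continuousAt_const) continuousAt_const (h.mono fun t ht => by simp [ht])
  exact sub_eq_zero.1 (norm_le_zero_iff.1 this)

theorem eventually_add_mem {U : Set ℂ} (hU : IsOpen U) {w : ℂ} (hw : w ∈ U) (σ : ℝ) :
    ∀ᶠ t : ℝ in 𝓝[>] 0, 0 < t ∧ w + σ * t ∈ U := by
  have hc : Tendsto (fun t : ℝ => w + σ * t) (𝓝[>] 0) (𝓝 w) := by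
    have : ContinuousAt (fun t : ℝ => w + σ * t) 0 := by fun_prop
    simpa [ContinuousAt] using this.tendsto.mono_left nhdsWithin_le_nhds
  exact Eventually.and self_mem_nhdsWithin (hc.eventually (hU.mem_nhds hw))

theorem re_ne_of_mem_domainG {m : Fin P} {w : ℂ} (hw : w ∈ domainG z) (h : (z m).im ≤ w.im) :
    w.re ≠ (z m).re := fun h0 =>
  absurd (mem_domainG_iff.1 hw m h0) (not_lt.2 (h.trans (le_abs_self _)))

theorem mem_domainG_of_mem_upperStrip (hre : StrictMono fun p => (z p).re) {m : Fin P} {r : ℝ}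
    (hr : IsIsolatingRadius z m r) {w : ℂ} (hw : w ∈ upperStrip z m r) (h : w.re ≠ (z m).re) :
    w ∈ domainG z := by
  rcases h.lt_or_gt with h | h
  · exact column_subset_domainG _ (hr.mem_column_left hre hw.1 h)
  · exact column_subset_domainG _ (hr.mem_column_right hre hw.1 h)

/-- Relation between the limits of a primitive on both sides of a cut and its limit at the branch
point. -/
theorem limit_relation_at_branchPoint (hε : 0 < ε) (hlam : lam < 0) (hz : ∀ p, 0 < (z p).im)
    (hre : StrictMono fun p => (z p).re) {m : Fin P} {r : ℝ} (hr : IsIsolatingRadius z m r)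
    (hF : ∀ w ∈ domainG z, HasDerivAt F (integrand ε lam c z φ w) w)
    {L : ℕ → ℂ} {C Y : ℝ} (hL : ∀ k, ∀ w ∈ column z k, Y < w.im →
      ‖F w - L k‖ ≤ C * Real.exp (-(-lam / ε) * w.im))
    (hα : 0 < (c m).im / ε) {Fm : ℂ} {C' : ℝ}
    (hFm : ∀ w ∈ domainG z, ‖w - z m‖ < r → ‖F w - Fm‖ ≤ C' * ‖w - z m‖ ^ ((c m).im / ε)) :
    exp (Real.pi * c m / ε) ^ 2 * (L m.val - Fm) = L (m.val + 1) - Fm := by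
  obtain ⟨Q, hQd, hQ⟩ := exists_continuation hε hlam hz hre hr hF hL
  set ρ := exp (Real.pi * c m / ε) with hρ
  have hρ0 : ρ ≠ 0 := exp_ne_zero _
  have hopen : IsOpen (upperStrip z m r ∩ Metric.ball (z m) r) :=
    (isOpen_upperStrip m r).inter Metric.isOpen_ball
  have hB : ∀ w, ContinuousAt (fun w : ℂ => C' * ‖w - z m‖ ^ ((c m).im / ε)) w := fun w =>
    continuousAt_const.mul (ContinuousAt.rpow_const (by fun_prop) (Or.inr hα.le))
  -- At a point on the cut both one-sided values of `F` are within `C' ‖w - z m‖ ^ α` of `Fm`, and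
  -- weighting the left one by `ρ ^ 2` eliminates `Q`. Letting `w` descend to `z m` makes the bound
  -- vanish.
  have hbound : ∀ w ∈ upperStrip z m r ∩ Metric.ball (z m) r, w.re = (z m).re →
      ‖ρ ^ 2 * (L m.val - Fm) - (L (m.val + 1) - Fm)‖ ≤
        (‖ρ ^ 2‖ + 1) * (C' * ‖w - z m‖ ^ ((c m).im / ε)) := by
    intro w hw hwre
    have hQc := (hQd w hw.1).continuousAt
    have h1 : ‖Q w / ρ + L m.val - Fm‖ ≤ C' * ‖w - z m‖ ^ ((c m).im / ε) := by
      refine norm_le_of_eventually_norm_le (A := fun w => Q w / ρ + L m.val - Fm) (σ := -1)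
        (by fun_prop) (hB w) ?_
      filter_upwards [eventually_add_mem hopen hw (-1)] with t ⟨ht, htm⟩
      have hlt : (w + (-1 : ℝ) * t).re < (z m).re := by simp [hwre, ht]
      rw [← (hQ _ htm.1).1 hlt]
      exact hFm _ (mem_domainG_of_mem_upperStrip hre hr htm.1 hlt.ne)
        (by simpa [dist_eq] using htm.2)
    have h2 : ‖Q w * ρ + L (m.val + 1) - Fm‖ ≤ C' * ‖w - z m‖ ^ ((c m).im / ε) := by
      refine norm_le_of_eventually_norm_le (A := fun w => Q w * ρ + L (m.val + 1) - Fm) (σ := 1)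
        (by fun_prop) (hB w) ?_
      filter_upwards [eventually_add_mem hopen hw 1] with t ⟨ht, htm⟩
      have hlt : (z m).re < (w + (1 : ℝ) * t).re := by simp [hwre, ht]
      rw [← (hQ _ htm.1).2 hlt]
      exact hFm _ (mem_domainG_of_mem_upperStrip hre hr htm.1 hlt.ne')
        (by simpa [dist_eq] using htm.2)
    have e : ρ ^ 2 * (L m.val - Fm) - (L (m.val + 1) - Fm) =
        ρ ^ 2 * (Q w / ρ + L m.val - Fm) - (Q w * ρ + L (m.val + 1) - Fm) := by
      field_simp
      ring
    rw [e]
    refine (norm_sub_le _ _).trans ?_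
    rw [norm_mul, add_mul, one_mul]
    gcongr
  have hlim : Tendsto (fun t : ℝ => (‖ρ ^ 2‖ + 1) *
      (C' * ‖(z m + t * I : ℂ) - z m‖ ^ ((c m).im / ε))) (𝓝[>] 0) (𝓝 0) := by
    have h1 : ContinuousAt (fun t : ℝ => (z m + t * I : ℂ)) 0 := by fun_prop
    have h2 : ContinuousAt (fun t : ℝ => (‖ρ ^ 2‖ + 1) *
      (C' * ‖(z m + t * I : ℂ) - z m‖ ^ ((c m).im / ε))) 0 :=
      continuousAt_const.mul (ContinuousAt.comp (f := fun t : ℝ => (z m + t * I : ℂ)) (hB _) h1)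
    have h3 := h2.tendsto.mono_left (nhdsWithin_le_nhds (s := Set.Ioi 0))
    simpa [Real.zero_rpow hα.ne'] using h3
  have hev : ∀ᶠ t : ℝ in 𝓝[>] 0, ‖ρ ^ 2 * (L m.val - Fm) - (L (m.val + 1) - Fm)‖ ≤
      (‖ρ ^ 2‖ + 1) * (C' * ‖(z m + t * I : ℂ) - z m‖ ^ ((c m).im / ε)) := by
    filter_upwards [self_mem_nhdsWithin, nhdsWithin_le_nhds (Iio_mem_nhds hr.pos)] with t ht htr
    have ht' : 0 < t := ht
    refine hbound _ ⟨⟨by simpa using hr.pos, by simpa using ht'⟩, ?_⟩ (by simp)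
    have : t < r := htr
    simpa [dist_eq, abs_of_pos ht'] using this
  exact sub_eq_zero.1 (norm_le_zero_iff.1 (ge_of_tendsto hlim hev))

/-- If `Φ` extends analytically across the cut above `z m`, then the limits of the contour integral
at `i∞` on both sides are proportional. -/
theorem limit_relation_of_analytic (hε : 0 < ε) (hlam : lam < 0) (hz : ∀ p, 0 < (z p).im)
    (hre : StrictMono fun p => (z p).re) (m : Fin P)
    (hF : ∀ w ∈ domainG z, HasDerivAt (integralFromNegInfty ε lam c z φ)
      (integrand ε lam c z φ w) w)
    {L : ℕ → ℂ} {C Y : ℝ} (hL : ∀ k, ∀ w ∈ column z k, Y < w.im →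
      ‖integralFromNegInfty ε lam c z φ w - L k‖ ≤ C * Real.exp (-(-lam / ε) * w.im))
    {Ψ : ℂ → ℂ} (hΨ : AnalyticOnNhd ℂ Ψ {x | 0 < x.im})
    (hΨΦ : ∀ x ∈ domainG z, 0 < x.im → Ψ x = Phi ε lam c z φ x) :
    L (m.val + 1) = exp (Real.pi * c m / ε) ^ 2 * L m.val := by
  obtain ⟨r, hr⟩ := exists_isIsolatingRadius hz hre m
  obtain ⟨Q, hQd, hQ⟩ := exists_continuation hε hlam hz hre hr hF hL
  set ρ := exp (Real.pi * c m / ε) with hρ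
  have hρ0 : ρ ≠ 0 := exp_ne_zero _
  have hq : -(I / (ε : ℂ)) ≠ 0 := neg_ne_zero.2 (div_ne_zero I_ne_zero (ofReal_ne_zero.2 hε.ne'))
  set q := -(I / (ε : ℂ)) with hqd
  set E₀ := expFactor ε lam c z (flipCut m) with hE₀
  set w₀ : ℂ := z m + I with hw₀
  have hmem : w₀ ∈ upperStrip z m r := ⟨by simpa [hw₀] using hr.pos, by simp [hw₀]⟩
  have him : 0 < w₀.im := (hz m).trans hmem.2
  -- This function is continuous at a point of the cut, and it is the constant `q ρ L m` on the left
  -- and `q L (m+1) / ρ` on the right.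
  have hA : ContinuousAt (fun w => Ψ w * E₀ w - q * Q w) w₀ :=
    ((hΨ w₀ him).continuousAt.mul (differentiableAt_expFactor
      (upperStrip_subset_branchDomain hz hr hmem)).continuousAt).sub
      (continuousAt_const.mul (hQd w₀ hmem).continuousAt)
  have hval : ∀ w ∈ upperStrip z m r, w.re ≠ (z m).re →
      Ψ w * expFactor ε lam c z (fun _ => I) w = q * integralFromNegInfty ε lam c z φ w := by
    intro w hw hne
    rw [hΨΦ w (mem_domainG_of_mem_upperStrip hre hr hw hne) ((hz m).trans hw.2), Phi_eq,
      mul_assoc, div_mul_cancel₀ _ (expFactor_ne_zero w)]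
  have hleft := eq_of_eventually_eq (a := q * ρ * L m.val) (σ := -1) hA (by
    filter_upwards [eventually_add_mem (isOpen_upperStrip m r) hmem (-1)] with t ⟨ht, htm⟩
    have hlt : (w₀ + (-1 : ℝ) * t).re < (z m).re := by simp [hw₀, ht]
    have h1 := hval _ htm hlt.ne
    rw [expFactor_left m hlt, (hQ _ htm).1 hlt, ← hρ, ← hE₀] at h1
    field_simp at h1
    linear_combination h1)
  have hright := eq_of_eventually_eq (a := q / ρ * L (m.val + 1)) (σ := 1) hA (by
    filter_upwards [eventually_add_mem (isOpen_upperStrip m r) hmem 1] with t ⟨ht, htm⟩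
    have hlt : (z m).re < (w₀ + (1 : ℝ) * t).re := by simp [hw₀, ht]
    have h1 := hval _ htm hlt.ne'
    rw [expFactor_right m hlt, (hQ _ htm).2 hlt, ← hρ, ← hE₀] at h1
    field_simp
    linear_combination h1)
  have h3 := hleft.symm.trans hright
  field_simp at h3
  linear_combination -h3

theorem differentiableAt_Phi
    (hF : ∀ w ∈ domainG z, HasDerivAt (integralFromNegInfty ε lam c z φ)
      (integrand ε lam c z φ w) w) {w : ℂ} (hw : w ∈ domainG z) :
    DifferentiableAt ℂ (Phi ε lam c z φ) w := by
  have : Phi ε lam c z φ = fun w => -(I / ε) *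
    (integralFromNegInfty ε lam c z φ w / expFactor ε lam c z (fun _ => I) w) := funext Phi_eq
  rw [this]
  exact ((hF w hw).differentiableAt.div (differentiableAt_expFactor (s := fun _ => I) hw)
    (expFactor_ne_zero w)).const_mul _

end BenjaminOno

end

/-! ### Analytic extension of `Φ` across the cuts and at the branch points. -/

noncomputable section

namespace BenjaminOno

variable {P : ℕ} {ε lam : ℝ} {c z φ : Fin P → ℂ}

/-- If the limits at `i∞` vanish, `Φ` extends analytically across the open upper cuts. -/
theorem exists_extension_of_ne_branchPoint (hε : 0 < ε) (hlam : lam < 0)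
    (hz : ∀ p, 0 < (z p).im) (hre : StrictMono fun p => (z p).re)
    (hF : ∀ w ∈ domainG z, HasDerivAt (integralFromNegInfty ε lam c z φ)
      (integrand ε lam c z φ w) w)
    {L : ℕ → ℂ} {C Y : ℝ} (hL : ∀ k, ∀ w ∈ column z k, Y < w.im →
      ‖integralFromNegInfty ε lam c z φ w - L k‖ ≤ C * Real.exp (-(-lam / ε) * w.im))
    (hL0 : ∀ k ≤ P, L k = 0) {w₀ : ℂ} (h0 : 0 < w₀.im) (hne : ∀ m, w₀ ≠ z m) :
    ∃ Θ : ℂ → ℂ, AnalyticAt ℂ Θ w₀ ∧ ∀ᶠ v in 𝓝 w₀, v ∈ domainG z → Θ v = Phi ε lam c z φ v := by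
  by_cases hG : w₀ ∈ domainG z
  · refine ⟨Phi ε lam c z φ, ?_, Eventually.of_forall fun _ _ => rfl⟩
    exact DifferentiableOn.analyticAt (s := domainG z)
      (fun w hw => (differentiableAt_Phi hF hw).differentiableWithinAt)
      (isOpen_domainG.mem_nhds hG)
  rw [mem_domainG_iff] at hG
  push Not at hG
  obtain ⟨m, hm, him⟩ := hG
  rw [abs_of_pos h0] at him
  have him' : (z m).im < w₀.im := him.lt_of_ne fun h => hne m (Complex.ext hm h.symm)
  obtain ⟨r, hr⟩ := exists_isIsolatingRadius hz hre m
  have hmem : w₀ ∈ upperStrip z m r := ⟨by simpa [hm] using hr.pos, him'⟩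
  obtain ⟨Q, hQd, hQ⟩ := exists_continuation hε hlam hz hre hr hF hL
  have hnh : upperStrip z m r ∈ 𝓝 w₀ := (isOpen_upperStrip m r).mem_nhds hmem
  -- With vanishing limits, `F` and `expFactor` carry the same power of `ρ` on each side, so their
  -- quotient equals this one on both.
  refine ⟨fun w => -(I / ε) * (Q w / expFactor ε lam c z (flipCut m) w), ?_, ?_⟩
  · refine DifferentiableOn.analyticAt (s := upperStrip z m r) (fun w hw => ?_) hnh
    exact (((hQd w hw).div (differentiableAt_expFactor
      (upperStrip_subset_branchDomain hz hr hw)) (expFactor_ne_zero w)).const_mul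
        _).differentiableWithinAt
  · filter_upwards [hnh] with v hv hvG
    rw [Phi_eq]
    have hρ0 : exp (Real.pi * c m / ε) ≠ 0 := exp_ne_zero _
    have hE : expFactor ε lam c z (flipCut m) v ≠ 0 := expFactor_ne_zero v
    rcases (re_ne_of_mem_domainG hvG hv.2.le).lt_or_gt with h | h
    · rw [(hQ v hv).1 h, expFactor_left m h, hL0 _ m.isLt.le]
      field_simp
      ring
    · rw [(hQ v hv).2 h, expFactor_right m h, hL0 _ m.isLt]
      field_simp
      ring

/-- Growth of a primitive of the integrand near a branch point, relative to the exponential factor: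
at most logarithmic, if the primitive is bounded on small circles where `Im (c m) ≤ 0`, and
vanishes at `z m` where `Im (c m) > 0`. -/
theorem exists_log_growth (hε : 0 < ε) (hz : ∀ p, 0 < (z p).im) {m : Fin P} {r : ℝ}
    (hr : IsIsolatingRadius z m r) {F : ℂ → ℂ}
    (hF : ∀ w ∈ domainG z, HasDerivAt F (integrand ε lam c z φ w) w)
    (hcircle : (c m).im / ε ≤ 0 →
      ∃ D, ∀ w ∈ domainG z, ‖w - z m‖ = r / 2 → ‖F w‖ ≤ D)
    (hlimit : 0 < (c m).im / ε → ∃ C : ℝ, ∀ w ∈ domainG z, ‖w - z m‖ < r →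
      ‖F w‖ ≤ C * ‖w - z m‖ ^ ((c m).im / ε)) :
    ∃ A B : ℝ, ∀ w ∈ domainG z, ‖w - z m‖ < r / 2 →
      ‖F w / expFactor ε lam c z (fun _ => I) w‖ ≤ A - B * Real.log ‖w - z m‖ := by
  have hne : ∀ w ∈ domainG z, w ≠ z m := fun w hw =>
    sub_ne_zero.1 (sub_ne_zero_of_mem_branchDomain (s := fun _ => I) hw m)
  obtain ⟨C, hC, hE⟩ := exists_norm_expFactor_near (lam := lam) (c := c) hε hz hr
  have hr0 := hr.pos
  rcases lt_or_ge 0 ((c m).im / ε) with hα | hα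
  · obtain ⟨D, hD⟩ := hlimit hα
    refine ⟨max D 0 * C, 0, fun w hw hwr => ?_⟩
    have h1 := (hE (fun _ => I) (by simp) w (hne w hw) (by linarith)).2
    have h2 := hD w hw (by linarith)
    rw [norm_div, div_le_iff₀ (norm_pos_iff.2 (expFactor_ne_zero w)), zero_mul, sub_zero, mul_assoc]
    calc _ ≤ D * ‖w - z m‖ ^ ((c m).im / ε) := h2
      _ ≤ max D 0 * ‖w - z m‖ ^ ((c m).im / ε) := by gcongr; exact le_max_left _ _
      _ ≤ _ := by gcongr
  · obtain ⟨D, hD⟩ := hcircle hα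
    obtain ⟨K, hK, hrad⟩ := exists_radial_estimate hε hz hr hα hF (half_pos hr0) (by linarith)
    refine ⟨(|D| / (r / 2) ^ ((c m).im / ε) + K * Real.log (r / 2)) * C, K * C, fun w hw hwr => ?_⟩
    have hupos : 0 < ‖w - z m‖ := norm_pos_iff.2 (sub_ne_zero.2 (hne w hw))
    have h1 := (hE (fun _ => I) (by simp) w (hne w hw) (by linarith)).2
    obtain ⟨v, hv, hvr, hwv⟩ := hrad w hw hwr.le
    have h2 := hD v hv hvr
    have hlog : Real.log ‖w - z m‖ ≤ Real.log (r / 2) := Real.log_le_log hupos hwr.le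
    have hpow : (r / 2) ^ ((c m).im / ε) ≤ ‖w - z m‖ ^ ((c m).im / ε) :=
      Real.rpow_le_rpow_of_nonpos hupos hwr.le hα
    have hpow0 : 0 < (r / 2) ^ ((c m).im / ε) := by positivity
    rw [norm_div, div_le_iff₀ (norm_pos_iff.2 (expFactor_ne_zero w))]
    have h3 : ‖F w‖ ≤ ‖F w - F v‖ + ‖F v‖ := by simpa using norm_add_le (F w - F v) (F v)
    have h4 : |D| ≤ |D| / (r / 2) ^ ((c m).im / ε) * ‖w - z m‖ ^ ((c m).im / ε) := by
      rw [div_mul_eq_mul_div, le_div_iff₀ hpow0]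
      exact mul_le_mul_of_nonneg_left hpow (abs_nonneg _)
    have h5 : 0 ≤ |D| / (r / 2) ^ ((c m).im / ε) +
        K * (Real.log (r / 2) - Real.log ‖w - z m‖) :=
      add_nonneg (by positivity) (mul_nonneg hK.le (by linarith))
    calc ‖F w‖ ≤ (|D| / (r / 2) ^ ((c m).im / ε) +
          K * (Real.log (r / 2) - Real.log ‖w - z m‖)) * ‖w - z m‖ ^ ((c m).im / ε) := by
          have := le_abs_self D
          linarith
      _ ≤ (|D| / (r / 2) ^ ((c m).im / ε) +
          K * (Real.log (r / 2) - Real.log ‖w - z m‖)) *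
            (C * ‖expFactor ε lam c z (fun _ => I) w‖) := by gcongr
      _ = _ := by ring

/-- If the limits at `i∞` vanish, and so does the contour integral at `z m` when `Im (c m) > 0`,
then the singularity of `Φ` at `z m` is removable. -/
theorem exists_extension_branchPoint (hε : 0 < ε) (hlam : lam < 0)
    (hz : ∀ p, 0 < (z p).im) (hre : StrictMono fun p => (z p).re)
    (hF : ∀ w ∈ domainG z, HasDerivAt (integralFromNegInfty ε lam c z φ)
      (integrand ε lam c z φ w) w)
    {L : ℕ → ℂ} {C Y : ℝ} (hL : ∀ k, ∀ w ∈ column z k, Y < w.im →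
      ‖integralFromNegInfty ε lam c z φ w - L k‖ ≤ C * Real.exp (-(-lam / ε) * w.im))
    (hL0 : ∀ k ≤ P, L k = 0) {m : Fin P} {r : ℝ} (hr : IsIsolatingRadius z m r)
    (hlimit : 0 < (c m).im / ε → ∃ C : ℝ, ∀ w ∈ domainG z, ‖w - z m‖ < r →
      ‖integralFromNegInfty ε lam c z φ w‖ ≤ C * ‖w - z m‖ ^ ((c m).im / ε)) :
    ∃ Θ : ℂ → ℂ, AnalyticAt ℂ Θ (z m) ∧
      ∀ᶠ v in 𝓝 (z m), v ∈ domainG z → Θ v = Phi ε lam c z φ v := by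
  have hr0 := hr.pos
  have hzm : z m ∉ domainG z := fun hm =>
    sub_ne_zero_of_mem_branchDomain (s := fun _ => I) hm m (sub_self _)
  have hq : -(I / (ε : ℂ)) ≠ 0 := neg_ne_zero.2 (div_ne_zero I_ne_zero (ofReal_ne_zero.2 hε.ne'))
  obtain ⟨Ψ, hΨ, hΨΦ⟩ := exists_analytic_extension (U := {w | w ≠ z m ∧ ‖w - z m‖ < r})
    dense_domainG (Φ := Phi ε lam c z φ) (fun w hw => by
      refine exists_extension_of_ne_branchPoint hε hlam hz hre hF hL hL0 (hr.im_pos hw.2.le)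
        fun p hp => ?_
      have h1 := hr.norm_sub_le hw.2.le p
      rw [← hp, sub_self, norm_zero, norm_le_zero_iff, sub_eq_zero] at h1
      exact hw.1 h1)
  -- On the circle of radius `r / 2` the function `Φ` has already been extended through the cut, so
  -- it is bounded by compactness; multiplying by the exponential factor bounds `F` there.
  obtain ⟨A, B, hAB⟩ := exists_log_growth hε hz hr hF (fun _ => by
    have hcomp : IsCompact (Metric.sphere (z m) (r / 2)) := isCompact_sphere _ _
    have hE : ∀ w ∈ Metric.sphere (z m) (r / 2), w ≠ z m ∧ ‖w - z m‖ < r := by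
      intro w hw
      rw [mem_sphere_iff_norm] at hw
      exact ⟨sub_ne_zero.1 (norm_pos_iff.1 (by linarith)), by linarith⟩
    obtain ⟨D, hD⟩ := hcomp.exists_bound_of_continuousOn
      (hΨ.continuousOn.mono fun w hw => hE w hw)
    obtain ⟨K, hK, hnear⟩ := exists_norm_expFactor_near (lam := lam) (c := c) hε hz hr
    refine ⟨D / ‖-(I / (ε : ℂ))‖ * (K * (r / 2) ^ ((c m).im / ε)), fun w hw hwr => ?_⟩
    have hws : w ∈ Metric.sphere (z m) (r / 2) := mem_sphere_iff_norm.2 hwr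
    have h1 := hD w hws
    have h2 := (hnear (fun _ => I) (by simp) w (hE w hws).1 (hE w hws).2.le).1
    rw [hwr] at h2
    rw [hΨΦ w (hE w hws) hw, Phi_eq, norm_mul, norm_div, mul_comm, ← le_div_iff₀ (norm_pos_iff.2 hq),
      div_le_iff₀ (norm_pos_iff.2 (expFactor_ne_zero w))] at h1
    refine h1.trans (mul_le_mul_of_nonneg_left h2 ?_)
    have : 0 ≤ D := (norm_nonneg _).trans (hD w hws)
    positivity) hlimit
  obtain ⟨Θ, hΘ, hΘΨ⟩ := exists_analyticAt_of_log_growth (G := domainG z) (Ψ := Ψ) (a := z m)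
    (r := r / 2) (A := ‖-(I / (ε : ℂ))‖ * A) (B := ‖-(I / (ε : ℂ))‖ * B)
    eventually_add_mem_domainG (by linarith)
    (fun w hw hwr => (hΨ w ⟨hw, by linarith⟩).differentiableAt)
    (fun w hwG hw hwr => by
      rw [hΨΦ w ⟨hw, by linarith⟩ hwG, Phi_eq, norm_mul, mul_assoc, ← mul_sub]
      exact mul_le_mul_of_nonneg_left (hAB w hwG hwr) (norm_nonneg _))
  refine ⟨Θ, hΘ, ?_⟩
  filter_upwards [Metric.ball_mem_nhds (z m) hr0] with v hv hvG
  have hne : v ≠ z m := ne_of_mem_of_not_mem hvG hzm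
  rw [hΘΨ v hne, hΨΦ v ⟨hne, by simpa [dist_eq] using hv⟩ hvG]

/-- If `Φ` extends analytically to `z m` and `Im (c m) > 0`, then the limit of the contour integral
at `z m` vanishes. -/
theorem limit_eq_zero_of_analytic (hε : 0 < ε) (hz : ∀ p, 0 < (z p).im) {m : Fin P} {r : ℝ}
    (hr : IsIsolatingRadius z m r) (hα : 0 < (c m).im / ε) {Fm : ℂ} {C : ℝ}
    (hFm : ∀ w ∈ domainG z, ‖w - z m‖ < r →
      ‖integralFromNegInfty ε lam c z φ w - Fm‖ ≤ C * ‖w - z m‖ ^ ((c m).im / ε))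
    {Ψ : ℂ → ℂ} (hΨ : AnalyticOnNhd ℂ Ψ {x | 0 < x.im})
    (hΨΦ : ∀ x ∈ domainG z, 0 < x.im → Ψ x = Phi ε lam c z φ x) : Fm = 0 := by
  have hq : -(I / (ε : ℂ)) ≠ 0 := neg_ne_zero.2 (div_ne_zero I_ne_zero (ofReal_ne_zero.2 hε.ne'))
  obtain ⟨K, hK, hnear⟩ := exists_norm_expFactor_near (lam := lam) (c := c) hε hz hr
  have hpow : ContinuousAt (fun w : ℂ => ‖w - z m‖ ^ ((c m).im / ε)) (z m) :=
    ContinuousAt.rpow_const (by fun_prop) (Or.inr hα.le)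
  have hB : ContinuousAt (fun w : ℂ => C * ‖w - z m‖ ^ ((c m).im / ε) +
      ‖Ψ w / -(I / (ε : ℂ))‖ * (K * ‖w - z m‖ ^ ((c m).im / ε))) (z m) :=
    (continuousAt_const.mul hpow).add ((((hΨ _ (hz m)).continuousAt.div_const _).norm).mul
      (continuousAt_const.mul hpow))
  -- Both `F - Fm` and `F`, a multiple of `Ψ * E`, are `O(‖w - z m‖ ^ α)`, hence so is `Fm`. At `w =
  -- z m` the bound is `0`.
  have h := norm_le_of_eventually_norm_le (A := fun _ => Fm) (σ := 1) continuousAt_const hB (by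
    filter_upwards [eventually_add_mem Metric.isOpen_ball (Metric.mem_ball_self hr.pos) 1,
      eventually_add_mem_domainG (z m)] with t ht htG
    rw [ofReal_one, one_mul] at ht ⊢
    have hwr : ‖z m + t - z m‖ < r := by simpa [dist_eq] using ht.2
    have hne : z m + (t : ℂ) ≠ z m := by simpa using ht.1.ne'
    generalize z m + (t : ℂ) = w at *
    have h1 := hFm w htG hwr
    have h2 := (hnear (fun _ => I) (by simp) w hne hwr.le).1
    have h3 : integralFromNegInfty ε lam c z φ w =
        Ψ w / -(I / (ε : ℂ)) * expFactor ε lam c z (fun _ => I) w := by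
      rw [hΨΦ w htG (hr.im_pos hwr.le), Phi_eq, mul_div_cancel_left₀ _ hq,
        div_mul_cancel₀ _ (expFactor_ne_zero w)]
    have h4 : ‖integralFromNegInfty ε lam c z φ w‖ ≤
        ‖Ψ w / -(I / (ε : ℂ))‖ * (K * ‖w - z m‖ ^ ((c m).im / ε)) := by
      rw [h3, norm_mul]
      gcongr
    have h5 := norm_sub_le (integralFromNegInfty ε lam c z φ w)
      (integralFromNegInfty ε lam c z φ w - Fm)
    rw [sub_sub_cancel] at h5
    linarith)
  simpa [Real.zero_rpow hα.ne'] using h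

end BenjaminOno

end

/-! ### Assembly: one vanishing condition for each pole. -/

theorem proposition3p2 {P : ℕ} (ε lam : ℝ) (hε : 0 < ε) (hlam : lam < 0)
    (z c : Fin P → ℂ) (hz : ∀ p, 0 < (z p).im) (hre : StrictMono fun p => (z p).re)
    (hc : ∀ p, c p ≠ 0) (hsum : ∑ p, (c p + (starRingEnd ℂ) (c p)) = 0)
    (φ : Fin P → ℂ) :
    -- the improper integral defining `Φ` converges
    (∀ x : ℝ, ∃ L : ℂ, Tendsto
      (fun A : ℝ => ∫ s in (-A)..x, BenjaminOno.integrand ε lam c z φ (s : ℂ)) atTop (𝓝 L)) ∧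
    -- for any choice of the contours `C_m^<`
    ∀ γ : Fin P → ℝ → ℂ, (∀ m, BenjaminOno.IsContourC ε c z m (γ m)) →
      -- the contour integrals are absolutely convergent
      (∀ m, IntegrableOn
        (fun t => BenjaminOno.integrand ε lam c z φ (γ m t) * deriv (γ m) t)
        (BenjaminOno.contourParam ε c m)) ∧
      -- `Φ` is analytic in the upper half-plane iff they all vanish
      (BenjaminOno.PhiAnalyticUpper ε lam c z φ ↔
        ∀ m, (∫ t in BenjaminOno.contourParam ε c m,
          BenjaminOno.integrand ε lam c z φ (γ m t) * deriv (γ m) t) = 0) := by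
  open BenjaminOno in
  obtain ⟨hconv, hF, L, C, Y, hL0, -, -, hL⟩ :=
    exists_column_limit_integralFromNegInfty (c := c) (φ := φ) hε hlam hz
  refine ⟨hconv, fun γ hγ => ?_⟩
  have hreg : ∀ m, ¬ Exceptional ε c m →
      IntegrableOn (fun t => integrand ε lam c z φ (γ m t) * deriv (γ m) t) (contourParam ε c m) ∧
      ∫ t in contourParam ε c m, integrand ε lam c z φ (γ m t) * deriv (γ m) t =
        L (m.val + 1) := by
    intro m hm
    have h1 := hγ m
    rw [IsContourC, if_neg hm] at h1
    have h2 := h1.integral_eq hε hlam hz hF hL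
    rw [hL0, sub_zero] at h2
    rw [contourParam, if_neg hm, setIntegral_univ, integrableOn_univ]
    exact h2
  choose r hr using exists_isIsolatingRadius hz hre
  have hlim := fun m (hα : 0 < (c m).im / ε) => exists_limit_at_branchPoint hε hz (hr m) hα hF
  choose Fm C' hFm using hlim
  have hpos : ∀ m, Exceptional ε c m → 0 < (c m).im / ε := fun m hm =>
    one_pos.trans_le hm.one_le
  have hexc : ∀ m, ∀ hm : Exceptional ε c m,
      IntegrableOn (fun t => integrand ε lam c z φ (γ m t) * deriv (γ m) t) (contourParam ε c m) ∧
      ∫ t in contourParam ε c m, integrand ε lam c z φ (γ m t) * deriv (γ m) t =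
        Fm m (hpos m hm) := by
    intro m hm
    have h1 := hγ m
    rw [IsContourC, if_pos hm] at h1
    have h2 := h1.integral_eq hε hlam hz hF hL (hr m) hm.one_le (hFm m (hpos m hm))
    rw [hL0, sub_zero] at h2
    rw [contourParam, if_pos hm]
    exact h2
  have hrel := fun m (hα : 0 < (c m).im / ε) =>
    limit_relation_at_branchPoint hε hlam hz hre (hr m) hF hL hα (hFm m hα)
  refine ⟨fun m => ?_, fun ⟨Ψ, hΨ, hΨΦ⟩ => ?_, fun hint => ?_⟩
  · by_cases hm : Exceptional ε c m
    · exact (hexc m hm).1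
    · exact (hreg m hm).1
  -- The relation `L (k+1) = ρ² L k` propagates zero from `L 0`, whether or not the pole is
  -- exceptional.
  · have hall : ∀ k ≤ P, L k = 0 := by
      intro k
      induction k with
      | zero => exact fun _ => hL0
      | succ k ih =>
        intro hk
        have h1 := limit_relation_of_analytic hε hlam hz hre ⟨k, hk⟩ hF hL hΨ hΨΦ
        simpa [ih (by omega)] using h1
    intro m
    by_cases hm : Exceptional ε c m
    · rw [(hexc m hm).2]
      exact limit_eq_zero_of_analytic hε hz (hr m) (hpos m hm) (hFm m _) hΨ hΨΦ
    · rw [(hreg m hm).2]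
      exact hall _ m.isLt
  · have hall : ∀ k ≤ P, L k = 0 := by
      intro k
      induction k with
      | zero => exact fun _ => hL0
      | succ k ih =>
        intro hk
        by_cases hm : Exceptional ε c ⟨k, hk⟩
        -- An exceptional pole gives no direct information on `L (k+1)`, but `ρ² = 1` forces `L
        -- (k+1) = L k`.
        · have h1 := hrel ⟨k, hk⟩ (hpos _ hm)
          rw [(exceptional_iff hε (hpos _ hm)).1 hm, one_mul] at h1
          have h2 := sub_left_injective h1
          rw [← h2, ih (by omega)]
        · rw [← (hreg ⟨k, hk⟩ hm).2]
          exact hint _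
    have hFm0 : ∀ m hα, Fm m hα = 0 := by
      intro m hα
      by_cases hm : Exceptional ε c m
      · rw [← (hexc m hm).2]
        exact hint m
      -- With both column limits zero the relation reads `ρ² Fm = Fm`. If `Fm ≠ 0`, then `ρ² = 1`
      -- and the pole would be exceptional.
      · have h1 := hrel m hα
        rw [hall _ m.isLt.le, hall _ m.isLt, zero_sub] at h1
        by_contra h0
        refine hm ((exceptional_iff hε hα).2 ?_)
        exact mul_right_cancel₀ (neg_ne_zero.2 h0) (h1.trans (one_mul _).symm)
    obtain ⟨Ψ, hΨ, hΨΦ⟩ := exists_analytic_extension (U := {x : ℂ | 0 < x.im})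
      dense_domainG (Φ := Phi ε lam c z φ) (fun w hw => by
        by_cases hwz : ∃ m, w = z m
        · obtain ⟨m, rfl⟩ := hwz
          refine exists_extension_branchPoint hε hlam hz hre hF hL hall (hr m) fun hα => ?_
          exact ⟨C' m hα, fun w hw hwr => by simpa [hFm0] using hFm m hα w hw hwr⟩
        · push Not at hwz
          exact exists_extension_of_ne_branchPoint hε hlam hz hre hF hL hall hw hwz)
    exact ⟨Ψ, hΨ, fun x hx hx0 => hΨΦ x hx0 hx⟩
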